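/- Let $d\ge 1$, $1<p<\infty$, $T>0$, $u_0\in L^2=L^2(\mathbb R^d)$, and let $$Av=-\operatorname{div}(|\nabla v|^{p-2}\nabla v),\qquad D(A)=\{v\in L^2:\ \nabla v\in L^p,\ \operatorname{div}(|\nabla v|^{p-2}\nabla v)\in L^2\},$$ where $\nabla$ and $\operatorname{div}$ are taken in the sense of distributions on $\mathbb R^d$. Let $u$ be the weak solution on $[0,T]$ of the parabolic $p$-Laplace equation $\partial_t u=\operatorname{div}(|\nabla u|^{p-2}\nabla u)$ with initial value $u_0$, that is, a function $$u\in C([0,T];L^2)\cap\bigcap_{0<\delta<T}W^{1,2}([\delta,T];L^2),\qquad u(0)=u_0,$$ such that $u(t)\in D(A)$ for a.e. $t\in(0,T)$; $t^{1/2}\frac{du}{dt}\in L^2(0,T;L^2)$, $t^{1/2}Au\in L^2(0,T;L^2)$ and $|\nabla u|\in L^p(0,T;L^p)$; and $\frac{du}{dt}(t)=-Au(t)=\operatorname{div}(|\nabla u(t)|^{p-2}\nabla u(t))$ for a.e. $t\in(0,T)$, where $\frac{du}{dt}$ is the strong derivative in $L^2$. Write $|\cdot|_q$ for the norm of $L^q(\mathbb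 R^d)$ and identify $u$ with a measurable function $u(t,x)$ on $(0,T)\times\mathbb R^d$. 1. If $u_0\in L^\infty\cap L^2$, then $u\in L^\infty((0,T)\times\mathbb R^d)$ and $|u(t)|_\infty\le|u_0|_\infty$ for a.e. $t\in(0,T)$. 2. If $u_0\in L^1\cap L^2$, then $u\in L^\infty(0,T;L^1)$. If in addition $u_0\ge0$ a.e. on $\mathbb R^d$, then $u\ge0$ a.e. on $(0,T)\times\mathbb R^d$. 3. If $u_0\in L^1\cap L^2$ and $p\ge d$, then, for all $t\in[0,T]$, $u(t)\in L^1$ and $$\int_{\mathbb R^d}u(t,x)\,dx=\int_{\mathbb R^d}u_0(x)\,dx.$$ -/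

import Mathlib

open MeasureTheory Set

namespace PLaplace

/-- Euclidean space `ℝ^d`. -/
abbrev Space (d : ℕ) : Type := EuclideanSpace ℝ (Fin d)

/-- The Hilbert space `H = L²(ℝ^d)`. -/
abbrev L2 (d : ℕ) : Type := Lp ℝ 2 (volume : Measure (Space d))

/-- Lebesgue measure on the cylinder `(0,T) × ℝ^d`. -/
noncomputable abbrev cylMeasure (d : ℕ) (T : ℝ) : Measure (ℝ × Space d) :=
  (volume : Measure (ℝ × Space d)).restrict (Ioo 0 T ×ˢ univ)

/-- `φ ∈ C_c^∞(V)`. -/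
def IsTestFunction {V : Type*} [NormedAddCommGroup V] [NormedSpace ℝ V] (φ : V → ℝ) : Prop :=
  ContDiff ℝ (⊤ : ℕ∞) φ ∧ HasCompactSupport φ

/-- `G = ∇v` in the sense of distributions on `ℝ^d` (tested in every direction `y`). -/
def HasWeakGradient {d : ℕ} (v : Space d → ℝ) (G : Space d → Space d) : Prop :=
  LocallyIntegrable v ∧ LocallyIntegrable G ∧
    ∀ φ : Space d → ℝ, IsTestFunction φ → ∀ y : Space d,
      ∫ x, v x * fderiv ℝ φ x y = -∫ x, φ x * inner ℝ (G x) y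

/-- `f = div F` in the sense of distributions on `ℝ^d`;
here `fderiv ℝ φ x (F x) = ∇φ(x) · F(x)`. -/
def HasWeakDivergence {d : ℕ} (F : Space d → Space d) (f : Space d → ℝ) : Prop :=
  LocallyIntegrable F ∧ LocallyIntegrable f ∧
    ∀ φ : Space d → ℝ, IsTestFunction φ →
      ∫ x, fderiv ℝ φ x (F x) = -∫ x, φ x * f x

/-- The graph of the operator `A v = -div(|∇v|^{p-2} ∇v)` in `L²(ℝ^d)`: `IsNegPLaplacian p v f`
says that `v` belongs to
`D(A) = {v ∈ L² : ∇v ∈ L^p, div(|∇v|^{p-2} ∇v) ∈ L²}` and that `A v = f`.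
Where `∇v = 0` the field `|∇v|^{p-2} ∇v` is `0`, also for `p < 2`. -/
def IsNegPLaplacian {d : ℕ} (p : ℝ) (v f : L2 d) : Prop :=
  ∃ G : Space d → Space d,
    MemLp G (ENNReal.ofReal p) volume ∧ HasWeakGradient v G ∧
      HasWeakDivergence (fun x => ‖G x‖ ^ (p - 2) • G x) (fun x => -f x)

/-- `u ∈ W^{1,2}([a,b];H)`: `u` and its `H`-valued distributional derivative on `(a,b)`
belong to `L²(a,b;H)`. -/
def MemW12 {H : Type*} [NormedAddCommGroup H] [NormedSpace ℝ H] (a b : ℝ) (u : ℝ → H) : Prop :=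
  MemLp u 2 (volume.restrict (Ioo a b)) ∧
    ∃ g : ℝ → H, MemLp g 2 (volume.restrict (Ioo a b)) ∧
      ∀ φ : ℝ → ℝ, IsTestFunction φ → tsupport φ ⊆ Ioo a b →
        ∫ t in Ioo a b, deriv φ t • u t = -∫ t in Ioo a b, φ t • g t

/-- `u : [0,T] → L²(ℝ^d)` is the weak solution on `[0,T]` of
`∂u/∂t = div(|∇u|^{p-2} ∇u)`, `u(0) = u₀` (values of `u` outside `[0,T]` are irrelevant). -/
structure IsWeakSolution {d : ℕ} (p T : ℝ) (u₀ : L2 d) (u : ℝ → L2 d) : Prop where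
  /-- `u ∈ C([0,T];L²)` -/
  continuousOn : ContinuousOn u (Icc 0 T)
  /-- `u(0) = u₀` -/
  initial : u 0 = u₀
  /-- `u ∈ W^{1,2}([δ,T];L²)` for all `0 < δ < T` -/
  memW12 : ∀ δ : ℝ, 0 < δ → δ < T → MemW12 δ T u
  /-- `|∇u| ∈ L^p(0,T;L^p) = L^p((0,T) × ℝ^d)` -/
  gradient : ∃ G : ℝ × Space d → Space d, MemLp G (ENNReal.ofReal p) (cylMeasure d T) ∧
    ∀ᵐ t ∂(volume.restrict (Ioo 0 T)), HasWeakGradient (u t) (fun x => G (t, x))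
  /-- `t^{1/2} du/dt ∈ L²(0,T;L²)` -/
  sqrt_deriv : MemLp (fun t => Real.sqrt t • deriv u t) 2 (volume.restrict (Ioo 0 T))
  /-- `u(t) ∈ D(A)` for a.e. `t`, `t^{1/2} Au ∈ L²(0,T;L²)`, and the strong derivative of `u`
  satisfies `du/dt(t) = -A u(t) = div(|∇u(t)|^{p-2} ∇u(t))` for a.e. `t ∈ (0,T)` -/
  equation : ∃ a : ℝ → L2 d,
    MemLp (fun t => Real.sqrt t • a t) 2 (volume.restrict (Ioo 0 T)) ∧
      ∀ᵐ t ∂(volume.restrict (Ioo 0 T)), IsNegPLaplacian p (u t) (a t) ∧ HasDerivAt u (-a t) t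

/-- `U` is the function `(t,x) ↦ u(t,x)` on `(0,T) × ℝ^d` (unique up to null sets) with which the
`L²`-valued function `u` is identified. -/
def IsSpaceTimeVersion {d : ℕ} (T : ℝ) (u : ℝ → L2 d) (U : ℝ × Space d → ℝ) : Prop :=
  AEStronglyMeasurable U (cylMeasure d T) ∧
    ∀ᵐ t ∂(volume.restrict (Ioo 0 T)), (fun x => U (t, x)) =ᵐ[volume] u t

/-- `u ∈ L^∞(0,T;L¹)`: for a.e. `t` the class `u(t)` lies in `L¹(ℝ^d)`, and as an `L¹`-valued
function `u` is Bochner measurable and essentially bounded. -/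
def MemLinftyL1 {d : ℕ} (T : ℝ) (u : ℝ → L2 d) : Prop :=
  ∃ v : ℝ → Lp ℝ 1 (volume : Measure (Space d)),
    MemLp v ⊤ (volume.restrict (Ioo 0 T)) ∧
      ∀ᵐ t ∂(volume.restrict (Ioo 0 T)), (v t : Space d → ℝ) =ᵐ[volume] u t

end PLaplace

/-!
Let `β` be a bounded, smooth and nondecreasing function vanishing near `0`, with primitive `j`.
Integrating by parts, `∫ β(v) A v = ∫ β'(v) |∇v|^p ≥ 0` for every `v ∈ D(A)`, so `∫ j(u(t))` is
nonincreasing in `t`. If `u₀ ≤ M` a.e. with `M ≥ 0`, functions `β` vanishing exactly on `(-∞, m]`,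
with `m` decreasing to `M`, give `u(t) ≤ M`; letting `β` increase to the indicator function of
`(0, ∞)` gives `∫ u(t)⁺ ≤ ∫ u₀⁺`. The same estimates hold for `-u`, which yields the bounds in
`L^∞` and `L^1` and the preservation of positivity.

For the mass, test the equation with cutoffs `χ_n(x) = χ(x / (n + 1))`. The change of `∫ χ_n u`
is at most the integral of `|∇χ_n| |∇u|^{p-1}` over `(0,T) × {n + 1 ≤ |x|}`. When `p ≥ d` the norms
`|∇χ_n|_p` stay bounded, so by Hölder's inequality this is controlled by a tail of the convergent
integral of `|∇u|^p`.
-/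

namespace PLaplace

open Filter Topology ContinuousLinearMap Metric
open scoped ENNReal NNReal

/-! ### Mollification -/

/-- The bump function with radii `1/(n+1)` and `2/(n+1)` around the origin; its normalization is
the mollifier of scale `2/(n+1)`. -/
noncomputable def stdBump (V : Type*) [NormedAddCommGroup V] (n : ℕ) : ContDiffBump (0 : V) where
  rIn := 1 / (n + 1)
  rOut := 2 / (n + 1)
  rIn_pos := by positivity
  rIn_lt_rOut := by gcongr; norm_num

theorem stdBump_rOut_le_two (V : Type*) [NormedAddCommGroup V] (n : ℕ) :
    (stdBump V n).rOut ≤ 2 :=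
  div_le_self zero_le_two (by simp)

theorem tendsto_stdBump_rOut (V : Type*) [NormedAddCommGroup V] :
    Tendsto (fun n => (stdBump V n).rOut) atTop (𝓝 0) := by
  simpa only [stdBump, mul_one_div, mul_zero] using
    (tendsto_one_div_add_atTop_nhds_zero_nat (𝕜 := ℝ)).const_mul 2

section Mollification

variable {V E : Type*} [NormedAddCommGroup V] [NormedSpace ℝ V] [FiniteDimensional ℝ V]
  [MeasurableSpace V] [BorelSpace V] (μ : Measure V) [NormedAddCommGroup E]
  [NormedSpace ℝ E]

/-- The mollification of `g` at scale `2/(n+1)`. -/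
noncomputable def mollify (n : ℕ) (g : V → E) : V → E :=
  convolution ((stdBump V n).normed μ) g (lsmul ℝ ℝ) μ

/-- The probability measure whose density is the mollifier: mollifying is averaging against it. -/
noncomputable def mollifierMeasure (n : ℕ) : Measure V :=
  μ.withDensity fun y => ENNReal.ofReal ((stdBump V n).normed μ y)

variable {μ} {g : V → E}

theorem mollify_eq_integral_mollifierMeasure (n : ℕ) (g : V → E) (x : V) :
    mollify μ n g x = ∫ y, g (x - y) ∂(mollifierMeasure μ n) := by
  have hmeas : Measurable fun y => ENNReal.ofReal ((stdBump V n).normed μ y) :=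
    (stdBump V n).continuous_normed.measurable.ennreal_ofReal
  rw [mollifierMeasure, integral_withDensity_eq_integral_toReal_smul hmeas
    (Eventually.of_forall fun _ => ENNReal.ofReal_lt_top), mollify, convolution_def]
  simp only [lsmul_apply, ENNReal.toReal_ofReal ((stdBump V n).nonneg_normed _)]

variable [μ.IsAddHaarMeasure]

theorem mollify_apply (n : ℕ) (g : V → E) (x : V) :
    mollify μ n g x = ∫ y, (stdBump V n).normed μ (x - y) • g y ∂μ :=
  convolution_lsmul_swap

theorem mollify_congr {g' : V → E} (h : g =ᵐ[μ] g') (n : ℕ) : mollify μ n g = mollify μ n g' :=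
  convolution_congr _ (ae_eq_refl _) h

theorem hasCompactSupport_normed_const_sub (n : ℕ) (x : V) :
    HasCompactSupport fun y => (stdBump V n).normed μ (x - y) :=
  (stdBump V n).hasCompactSupport_normed.comp_homeomorph (Homeomorph.subLeft x)

theorem integrable_normed_const_sub_smul (hg : LocallyIntegrable g μ) (n : ℕ) (x : V) :
    Integrable (fun y => (stdBump V n).normed μ (x - y) • g y) μ :=
  hg.integrable_smul_left_of_hasCompactSupport
    ((stdBump V n).continuous_normed.comp (continuous_sub_left x))
    (hasCompactSupport_normed_const_sub n x)

theorem mollify_sub {g' : V → E} (hg : LocallyIntegrable g μ) (hg' : LocallyIntegrable g' μ)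
    (n : ℕ) : mollify μ n (g - g') = mollify μ n g - mollify μ n g' := by
  ext x
  simp only [mollify_apply, Pi.sub_apply, smul_sub]
  exact integral_sub (integrable_normed_const_sub_smul hg n x)
    (integrable_normed_const_sub_smul hg' n x)

theorem contDiff_mollify (hg : LocallyIntegrable g μ) (n : ℕ) :
    ContDiff ℝ (⊤ : ℕ∞) (mollify μ n g) :=
  (stdBump V n).hasCompactSupport_normed.contDiff_convolution_left _
    (stdBump V n).contDiff_normed hg

theorem fderiv_mollify_apply {w : V → E} (hg : LocallyIntegrable g μ) {n : ℕ} {x y : V}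
    (h : ∫ z, fderiv ℝ (fun z => (stdBump V n).normed μ (x - z)) z y • g z ∂μ =
      -∫ z, (stdBump V n).normed μ (x - z) • w z ∂μ) :
    fderiv ℝ (mollify μ n g) x y = mollify μ n w x := by
  have hcs := (stdBump V n).hasCompactSupport_normed (μ := μ)
  have hC1 : ContDiff ℝ 1 ((stdBump V n).normed μ) := (stdBump V n).contDiff_normed (n := 1)
  have hconv : fderiv ℝ (mollify μ n g) x =
      ∫ z, (lsmul ℝ ℝ : ℝ →L[ℝ] E →L[ℝ] E).precompL V
        (fderiv ℝ ((stdBump V n).normed μ) (x - z)) (g z) ∂μ :=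
    (hcs.hasFDerivAt_convolution_left (lsmul ℝ ℝ) hC1 hg x).fderiv.trans
      (convolution_eq_swap _)
  have hint := (((hcs.fderiv ℝ).convolutionExists_left
    ((lsmul ℝ ℝ : ℝ →L[ℝ] E →L[ℝ] E).precompL V)
    (hC1.continuous_fderiv one_ne_zero) hg) x).integrable_swap
  have hreflect : ∀ z, fderiv ℝ (fun z => (stdBump V n).normed μ (x - z)) z y =
      -fderiv ℝ ((stdBump V n).normed μ) (x - z) y := fun z => by
    have hsub : HasFDerivAt (fun z => x - z) (-ContinuousLinearMap.id ℝ V) z :=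
      (hasFDerivAt_id z).const_sub x
    have hcomp : HasFDerivAt (fun z => (stdBump V n).normed μ (x - z))
        ((fderiv ℝ ((stdBump V n).normed μ) (x - z)).comp (-ContinuousLinearMap.id ℝ V)) z :=
      (hC1.differentiable one_ne_zero (x - z)).hasFDerivAt.comp z hsub
    simp [hcomp.fderiv]
  rw [hconv, integral_apply hint, mollify_apply]
  simp only [hreflect, neg_smul, integral_neg, neg_inj] at h
  simpa only [precompL_apply, lsmul_apply] using h

theorem ae_tendsto_mollify [CompleteSpace E] (hg : LocallyIntegrable g μ) :
    ∀ᵐ x ∂μ, Tendsto (fun n => mollify μ n g x) atTop (𝓝 (g x)) :=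
  ContDiffBump.ae_convolution_tendsto_right_of_locallyIntegrable (K := 2)
    (tendsto_stdBump_rOut V) (Eventually.of_forall fun _ => (mul_one_div _ _).ge) hg

theorem tendsto_mollify_of_continuousAt [CompleteSpace E] {x : V}
    (hg : AEStronglyMeasurable g μ) (hx : ContinuousAt g x) :
    Tendsto (fun n => mollify μ n g x) atTop (𝓝 (g x)) :=
  ContDiffBump.convolution_tendsto_right (tendsto_stdBump_rOut V)
    (Eventually.of_forall fun _ => hg) (hx.tendsto.comp tendsto_snd) tendsto_const_nhds

theorem support_mollify_subset (n : ℕ) (g : V → E) :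
    Function.support (mollify μ n g) ⊆ cthickening 2 (tsupport g) := by
  intro x hx
  obtain ⟨y, hy, z, hz, rfl⟩ := support_convolution_subset (lsmul ℝ ℝ) hx
  rw [(stdBump V n).support_normed_eq, mem_ball_zero_iff] at hy
  refine mem_cthickening_of_dist_le _ z _ _ (subset_tsupport g hz) ?_
  simpa only [dist_add_self_left] using hy.le.trans (stdBump_rOut_le_two V n)

theorem eventually_dist_mollify_le [CompleteSpace E] (hg : UniformContinuous g) {ε : ℝ}
    (hε : 0 < ε) : ∀ᶠ n in atTop, ∀ x, dist (mollify μ n g x) (g x) ≤ ε := by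
  obtain ⟨δ, hδ, hgδ⟩ := Metric.uniformContinuous_iff.1 hg ε hε
  filter_upwards [(tendsto_stdBump_rOut V).eventually (gt_mem_nhds hδ)] with n hn x
  exact ContDiffBump.dist_normed_convolution_le hg.continuous.aestronglyMeasurable
    fun y hy => (hgδ ((mem_ball.1 hy).trans hn)).le

instance (n : ℕ) : IsProbabilityMeasure (mollifierMeasure μ n) where
  measure_univ := by
    rw [mollifierMeasure, withDensity_apply _ MeasurableSet.univ, Measure.restrict_univ,
      ← ofReal_integral_eq_lintegral_ofReal (stdBump V n).integrable_normed
        (Eventually.of_forall (stdBump V n).nonneg_normed),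
      (stdBump V n).integral_normed, ENNReal.ofReal_one]

theorem enorm_mollify_rpow_le {p : ℝ} (hp : 1 ≤ p) (hg : StronglyMeasurable g) (n : ℕ) (x : V) :
    ‖mollify μ n g x‖ₑ ^ p ≤ ∫⁻ y, ‖g (x - y)‖ₑ ^ p ∂(mollifierMeasure μ n) := by
  have hp₀ : 0 < p := one_pos.trans_le hp
  have hgx : StronglyMeasurable fun y => g (x - y) := hg.comp_measurable (by fun_prop)
  rw [lintegral_rpow_enorm_eq_rpow_eLpNorm' hp₀, mollify_eq_integral_mollifierMeasure]
  gcongr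
  calc ‖∫ y, g (x - y) ∂(mollifierMeasure μ n)‖ₑ
      ≤ ∫⁻ y, ‖g (x - y)‖ₑ ∂(mollifierMeasure μ n) := enorm_integral_le_lintegral_enorm _
    _ = eLpNorm' (fun y => g (x - y)) 1 (mollifierMeasure μ n) := by simp [eLpNorm']
    _ ≤ eLpNorm' (fun y => g (x - y)) p (mollifierMeasure μ n) :=
        eLpNorm'_le_eLpNorm'_of_exponent_le one_pos hp _ hgx.aestronglyMeasurable

theorem lintegral_enorm_mollify_rpow_le {p : ℝ} (hp : 1 ≤ p) (hg : StronglyMeasurable g) (n : ℕ) :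
    ∫⁻ x, ‖mollify μ n g x‖ₑ ^ p ∂μ ≤ ∫⁻ x, ‖g x‖ₑ ^ p ∂μ := by
  have hmeas : StronglyMeasurable fun z : V × V => g (z.1 - z.2) :=
    hg.comp_measurable (measurable_fst.sub measurable_snd)
  calc ∫⁻ x, ‖mollify μ n g x‖ₑ ^ p ∂μ
      ≤ ∫⁻ x, ∫⁻ y, ‖g (x - y)‖ₑ ^ p ∂(mollifierMeasure μ n) ∂μ :=
        lintegral_mono (enorm_mollify_rpow_le hp hg n)
    _ = ∫⁻ y, ∫⁻ x, ‖g (x - y)‖ₑ ^ p ∂μ ∂(mollifierMeasure μ n) :=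
        lintegral_lintegral_swap (hmeas.enorm.pow_const p).aemeasurable
    _ = ∫⁻ _, ∫⁻ x, ‖g x‖ₑ ^ p ∂μ ∂(mollifierMeasure μ n) := by
        simp only [lintegral_sub_right_eq_self fun x => ‖g x‖ₑ ^ p]
    _ = ∫⁻ x, ‖g x‖ₑ ^ p ∂μ := by rw [lintegral_const, measure_univ, mul_one]

variable {q : ℝ≥0∞}

theorem eLpNorm_mollify_le (hq : 1 ≤ q) (hq' : q ≠ ∞) (hg : AEStronglyMeasurable g μ)
    (n : ℕ) : eLpNorm (mollify μ n g) q μ ≤ eLpNorm g q μ := by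
  wlog hgm : StronglyMeasurable g generalizing g
  · rw [mollify_congr hg.ae_eq_mk, eLpNorm_congr_ae hg.ae_eq_mk]
    exact this hg.stronglyMeasurable_mk.aestronglyMeasurable hg.stronglyMeasurable_mk
  have hq₀ : q ≠ 0 := (one_pos.trans_le hq).ne'
  have hq₁ : 1 ≤ q.toReal := by simpa using ENNReal.toReal_mono hq' hq
  simp only [eLpNorm_eq_lintegral_rpow_enorm_toReal hq₀ hq']
  gcongr ?_ ^ _
  exact lintegral_enorm_mollify_rpow_le hq₁ hgm n

theorem memLp_mollify (hq : 1 ≤ q) (hq' : q ≠ ∞) (hg : MemLp g q μ) (n : ℕ) :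
    MemLp (mollify μ n g) q μ :=
  ⟨(contDiff_mollify (hg.locallyIntegrable hq) n).continuous.aestronglyMeasurable,
    (eLpNorm_mollify_le hq hq' hg.1 n).trans_lt hg.2⟩

variable [CompleteSpace E]

theorem tendsto_eLpNorm_mollify_sub_of_hasCompactSupport (hq : q ≠ ∞) (hgc : Continuous g)
    (hgs : HasCompactSupport g) :
    Tendsto (fun n => eLpNorm (mollify μ n g - g) q μ) atTop (𝓝 0) := by
  set K := cthickening 2 (tsupport g)
  have hK : IsCompact K := hgs.isCompact.cthickening
  have hgK : Function.support g ⊆ K := (subset_tsupport g).trans (self_subset_cthickening _)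
  have hbound : ∀ ε : ℝ, 0 < ε → ∀ᶠ n in atTop, eLpNorm (mollify μ n g - g) q μ ≤
      ENNReal.ofReal ε * μ K ^ (1 / q.toReal) := fun ε hε => by
    filter_upwards [eventually_dist_mollify_le
      (hgs.uniformContinuous_of_continuous hgc) (μ := μ) hε] with n hn
    exact eLpNorm_sub_le_of_dist_bdd μ hq hK.measurableSet hε.le hn
      (support_mollify_subset (μ := μ) n g) hgK
  have hlim : Tendsto (fun ε : ℝ => ENNReal.ofReal ε * μ K ^ (1 / q.toReal)) (𝓝[>] 0) (𝓝 0) := by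
    have hconst : μ K ^ (1 / q.toReal) ≠ ∞ :=
      ENNReal.rpow_ne_top_of_nonneg (by positivity) hK.measure_lt_top.ne
    simpa using ENNReal.Tendsto.mul_const (ENNReal.tendsto_ofReal
      (tendsto_nhdsWithin_of_tendsto_nhds (tendsto_id (α := ℝ) (x := 𝓝 0)))) (Or.inr hconst)
  refine ENNReal.tendsto_nhds_zero.2 fun η hη => ?_
  obtain ⟨ε, hεη, hε⟩ :=
    ((ENNReal.tendsto_nhds_zero.1 hlim η hη).and self_mem_nhdsWithin).exists
  exact (hbound ε hε).mono fun n hn => hn.trans hεη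

theorem tendsto_eLpNorm_mollify_sub (hq : 1 ≤ q) (hq' : q ≠ ∞) (hg : MemLp g q μ) :
    Tendsto (fun n => eLpNorm (mollify μ n g - g) q μ) atTop (𝓝 0) := by
  refine ENNReal.tendsto_nhds_zero.2 fun ε hε => ?_
  have hε₃ : 0 < ε / 3 := ENNReal.div_pos hε.ne' (by simp)
  obtain ⟨h, hhs, hgh, hhc, hh⟩ := hg.exists_hasCompactSupport_eLpNorm_sub_le hq' hε₃.ne'
  have hlim := tendsto_eLpNorm_mollify_sub_of_hasCompactSupport (μ := μ) hq' hhc hhs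
  filter_upwards [ENNReal.tendsto_nhds_zero.1 hlim (ε / 3) hε₃] with n hn
  have hloc := (hg.sub hh).locallyIntegrable hq
  have hhloc := hh.locallyIntegrable hq
  have hsplit : mollify μ n g - g = mollify μ n (g - h) + (mollify μ n h - h) - (g - h) := by
    rw [mollify_sub (hg.locallyIntegrable hq) hhloc]
    abel
  have hmeas := (contDiff_mollify hloc n).continuous.aestronglyMeasurable (μ := μ)
  have hmeas' := ((contDiff_mollify hhloc n).continuous.sub hhc).aestronglyMeasurable (μ := μ)
  calc eLpNorm (mollify μ n g - g) q μ
      ≤ eLpNorm (mollify μ n (g - h)) q μ + eLpNorm (mollify μ n h - h) q μ +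
          eLpNorm (g - h) q μ := by
        rw [hsplit]
        exact (eLpNorm_sub_le (hmeas.add hmeas') (hg.sub hh).1 hq).trans
          (add_le_add_left (eLpNorm_add_le hmeas hmeas' hq) _)
    _ ≤ ε / 3 + ε / 3 + ε / 3 := by
        gcongr
        exact (eLpNorm_mollify_le hq hq' (hg.sub hh).1 n).trans hgh
    _ = ε := ENNReal.add_thirds ε

end Mollification

/-! ### Absolutely continuous curves -/

section Time

theorem absolutelyContinuousOnInterval_of_dist_le_mul {X Y : Type*} [PseudoMetricSpace X]
    [PseudoMetricSpace Y] {f : ℝ → X} {g : ℝ → Y} {a b C : ℝ}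
    (hg : AbsolutelyContinuousOnInterval g a b)
    (hfg : ∀ x ∈ uIcc a b, ∀ y ∈ uIcc a b, dist (f x) (f y) ≤ C * dist (g x) (g y)) :
    AbsolutelyContinuousOnInterval f a b := by
  refine squeeze_zero' (Eventually.of_forall fun _ => Finset.sum_nonneg fun _ _ => dist_nonneg)
    (eventually_inf_principal.2 (Eventually.of_forall fun E hE =>
      Finset.sum_le_sum fun i hi => hfg _ (hE.1 i hi).1 _ (hE.1 i hi).2)) ?_
  simpa only [← Finset.mul_sum, mul_zero] using Tendsto.const_mul C hg

theorem right_le_left_of_antitoneOn_Ioo {F : ℝ → ℝ} {a b : ℝ} (hab : a ≤ b)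
    (hF : ContinuousOn F (Icc a b)) (hanti : AntitoneOn F (Ioo a b)) : F b ≤ F a := by
  obtain rfl | hab := hab.eq_or_lt
  · rfl
  obtain ⟨c, hac, hcb⟩ := exists_between hab
  have hleft : F c ≤ F a :=
    ContinuousWithinAt.closure_le (s := Ioo a c) (f := fun _ => F c)
      (closure_Ioo hac.ne ▸ left_mem_Icc.2 hac.le) continuousWithinAt_const
      ((hF a (left_mem_Icc.2 hab.le)).mono fun x hx => ⟨hx.1.le, (hx.2.trans hcb).le⟩)
      fun s hs => hanti ⟨hs.1, hs.2.trans hcb⟩ ⟨hac, hcb⟩ hs.2.le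
  have hright : F b ≤ F c :=
    ContinuousWithinAt.closure_le (s := Ioo c b) (g := fun _ => F c)
      (closure_Ioo hcb.ne ▸ right_mem_Icc.2 hcb.le)
      ((hF b (right_mem_Icc.2 hab.le)).mono fun x hx => ⟨(hac.trans hx.1).le, hx.2.le⟩)
      continuousWithinAt_const fun t ht => hanti ⟨hac, hcb⟩ ⟨hac.trans ht.1, ht.2⟩ ht.1.le
  exact hright.trans hleft

variable {f h : ℝ → ℝ} {a b : ℝ}

theorem sub_le_integral_of_ae_hasDerivAt_le (hab : a ≤ b)
    (hf : AbsolutelyContinuousOnInterval f a b) (hh : IntervalIntegrable h volume a b)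
    (hderiv : ∀ᵐ t ∂(volume.restrict (Ioo a b)), ∃ f' ≤ h t, HasDerivAt f f' t) :
    f b - f a ≤ ∫ t in a..b, h t := by
  rw [← hf.integral_deriv_eq_sub]
  refine intervalIntegral.integral_mono_ae_restrict hab hf.intervalIntegrable_deriv hh ?_
  rw [← restrict_Ioo_eq_restrict_Icc]
  filter_upwards [hderiv] with t ⟨f', hf'h, hf'⟩
  rwa [hf'.deriv]

theorem sub_le_integral_of_locally_absolutelyContinuous (hab : a ≤ b)
    (hf : ContinuousOn f (Icc a b))
    (hac : ∀ s ∈ Ioo a b, ∀ t ∈ Ioo a b, AbsolutelyContinuousOnInterval f s t)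
    (hh : IntervalIntegrable h volume a b)
    (hderiv : ∀ᵐ t ∂(volume.restrict (Ioo a b)), ∃ f' ≤ h t, HasDerivAt f f' t) :
    f b - f a ≤ ∫ t in a..b, h t := by
  have hint : ∀ s ∈ Icc a b, ∀ t ∈ Icc a b, IntervalIntegrable h volume s t := fun s hs t ht =>
    hh.mono_set (uIcc_subset_uIcc (Icc_subset_uIcc hs) (Icc_subset_uIcc ht))
  have hcont : ContinuousOn (fun x => f x - ∫ t in a..x, h t) (Icc a b) :=
    hf.sub (uIcc_of_le hab ▸ intervalIntegral.continuousOn_primitive_interval' hh left_mem_uIcc)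
  have hle := right_le_left_of_antitoneOn_Ioo hab hcont fun s hs t ht hst => by
    have hst' := sub_le_integral_of_ae_hasDerivAt_le hst (hac s hs t ht)
      (hint s (Ioo_subset_Icc_self hs) t (Ioo_subset_Icc_self ht))
      (ae_restrict_of_ae_restrict_of_subset (Ioo_subset_Ioo hs.1.le ht.2.le) hderiv)
    have hadd := intervalIntegral.integral_interval_sub_left
      (hint a (left_mem_Icc.2 hab) t (Ioo_subset_Icc_self ht))
      (hint a (left_mem_Icc.2 hab) s (Ioo_subset_Icc_self hs))
    linarith
  simp only [intervalIntegral.integral_same, sub_zero] at hle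
  linarith

theorem abs_sub_le_integral_of_locally_absolutelyContinuous (hab : a ≤ b)
    (hf : ContinuousOn f (Icc a b))
    (hac : ∀ s ∈ Ioo a b, ∀ t ∈ Ioo a b, AbsolutelyContinuousOnInterval f s t)
    (hh : IntervalIntegrable h volume a b)
    (hderiv : ∀ᵐ t ∂(volume.restrict (Ioo a b)), ∃ f', |f'| ≤ h t ∧ HasDerivAt f f' t) :
    |f b - f a| ≤ ∫ t in a..b, h t := by
  refine abs_le'.2 ⟨?_, ?_⟩
  · exact sub_le_integral_of_locally_absolutelyContinuous hab hf hac hh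
      (hderiv.mono fun t ⟨f', hle, hf'⟩ => ⟨f', (le_abs_self f').trans hle, hf'⟩)
  · have hneg := sub_le_integral_of_locally_absolutelyContinuous hab hf.neg
      (fun s hs t ht => (hac s hs t ht).neg) hh
      (hderiv.mono fun t ⟨f', hle, hf'⟩ => ⟨-f', (neg_le_abs f').trans hle, hf'.neg⟩)
    simp only [Pi.neg_apply] at hneg
    linarith

variable {H : Type*} [NormedAddCommGroup H] [NormedSpace ℝ H] {u g : ℝ → H}

theorem hasDerivAt_mollify_of_weakDeriv (hu : IntegrableOn u (Ioo a b))
    (hug : ∀ φ : ℝ → ℝ, IsTestFunction φ → tsupport φ ⊆ Ioo a b →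
      ∫ t in Ioo a b, deriv φ t • u t = -∫ t in Ioo a b, φ t • g t)
    {n : ℕ} {x : ℝ} (hx : closedBall x (stdBump ℝ n).rOut ⊆ Ioo a b) :
    HasDerivAt (mollify volume n ((Ioo a b).indicator u))
      (mollify volume n ((Ioo a b).indicator g) x) x := by
  have hloc : LocallyIntegrable ((Ioo a b).indicator u) :=
    (hu.integrable_indicator measurableSet_Ioo).locallyIntegrable
  have hsupp : tsupport (fun z => (stdBump ℝ n).normed volume (x - z)) ⊆ Ioo a b := by
    refine (closure_minimal (fun z hz => ?_) isClosed_closedBall).trans hx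
    rw [Function.mem_support, ← Function.mem_support, ContDiffBump.support_normed_eq,
      mem_ball_zero_iff] at hz
    rw [mem_closedBall', dist_eq_norm]
    exact hz.le
  have htest : IsTestFunction fun z => (stdBump ℝ n).normed volume (x - z) :=
    ⟨(stdBump ℝ n).contDiff_normed.comp (contDiff_const.sub contDiff_id),
      hasCompactSupport_normed_const_sub n x⟩
  have hweak := hug _ htest hsupp
  simp only [← integral_indicator measurableSet_Ioo, indicator_smul] at hweak
  rw [← fderiv_mollify_apply (y := 1) hloc hweak]
  exact ((contDiff_mollify hloc n).differentiable (by simp) x).hasDerivAt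

variable [CompleteSpace H]

theorem MemW12.sub_eq_integral (hu : MemW12 a b u) (hc : ContinuousOn u (Ioo a b)) :
    ∃ g : ℝ → H, Integrable g ∧
      ∀ s ∈ Ioo a b, ∀ t ∈ Ioo a b, u t - u s = ∫ x in s..t, g x := by
  obtain ⟨huL2, g, hgL2, hug⟩ := hu
  have huint : IntegrableOn u (Ioo a b) := huL2.integrable one_le_two
  have hgint : Integrable ((Ioo a b).indicator g) :=
    IntegrableOn.integrable_indicator (hgL2.integrable one_le_two) measurableSet_Ioo
  refine ⟨(Ioo a b).indicator g, hgint, fun s hs t ht => ?_⟩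
  have hpt : ∀ r ∈ Ioo a b, Tendsto (fun n => mollify volume n ((Ioo a b).indicator u) r) atTop
      (𝓝 (u r)) := fun r hr => by
    have heq : (Ioo a b).indicator u =ᶠ[𝓝 r] u :=
      Filter.mem_of_superset (isOpen_Ioo.mem_nhds hr) fun x hx => indicator_of_mem hx u
    simpa only [indicator_of_mem hr] using tendsto_mollify_of_continuousAt
      (huint.integrable_indicator measurableSet_Ioo).1
      ((hc.continuousAt (isOpen_Ioo.mem_nhds hr)).congr heq.symm)
  have hint : ∀ n, Integrable (mollify volume n ((Ioo a b).indicator g)) := fun n =>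
    memLp_one_iff_integrable.1 (memLp_mollify le_rfl ENNReal.one_ne_top
      (memLp_one_iff_integrable.2 hgint) n)
  have hlim := tendsto_eLpNorm_mollify_sub le_rfl ENNReal.one_ne_top
    (memLp_one_iff_integrable.2 hgint)
  have hRHS : Tendsto (fun n => ∫ x in s..t, mollify volume n ((Ioo a b).indicator g) x) atTop
      (𝓝 (∫ x in s..t, (Ioo a b).indicator g x)) :=
    (tendsto_setIntegral_of_L1' _ hgint.1 (Eventually.of_forall hint) hlim _).sub
      (tendsto_setIntegral_of_L1' _ hgint.1 (Eventually.of_forall hint) hlim _)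
  refine tendsto_nhds_unique ((hpt t ht).sub (hpt s hs)) (hRHS.congr' ?_)
  obtain ⟨δ, hδ, hδab⟩ := isCompact_uIcc.exists_cthickening_subset_open isOpen_Ioo
    (ordConnected_Ioo.uIcc_subset hs ht)
  filter_upwards [(tendsto_stdBump_rOut ℝ).eventually (gt_mem_nhds hδ)] with n hn
  exact intervalIntegral.integral_eq_sub_of_hasDerivAt (fun x hx =>
    hasDerivAt_mollify_of_weakDeriv huint hug ((closedBall_subset_closedBall hn.le).trans
      ((closedBall_subset_cthickening hx δ).trans hδab))) (hint n).intervalIntegrable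

theorem MemW12.absolutelyContinuousOnInterval (hu : MemW12 a b u) (hc : ContinuousOn u (Ioo a b))
    {s t : ℝ} (hs : s ∈ Ioo a b) (ht : t ∈ Ioo a b) : AbsolutelyContinuousOnInterval u s t := by
  obtain ⟨g, hg, hug⟩ := hu.sub_eq_integral hc
  have hsub : uIcc s t ⊆ Ioo a b := ordConnected_Ioo.uIcc_subset hs ht
  have hnorm : IntervalIntegrable (fun x => ‖g x‖) volume s t := hg.norm.intervalIntegrable
  refine absolutelyContinuousOnInterval_of_dist_le_mul (C := 1)
    (hnorm.absolutelyContinuousOnInterval_intervalIntegral left_mem_uIcc) fun x hx y hy => ?_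
  rw [one_mul, dist_comm, dist_eq_norm, hug x (hsub hx) y (hsub hy), dist_comm, Real.dist_eq,
    intervalIntegral.integral_interval_sub_left hg.norm.intervalIntegrable
      hg.norm.intervalIntegrable]
  exact intervalIntegral.norm_integral_le_abs_integral_norm

end Time

/-! ### Cutoff functions -/

section Cutoff

variable {V : Type*} [NormedAddCommGroup V] [NormedSpace ℝ V] [HasContDiffBump V]

/-- A smooth bump equal to `1` on the unit ball and supported in the ball of radius `2`. -/
noncomputable def unitBump (V : Type*) [NormedAddCommGroup V] : ContDiffBump (0 : V) where
  rIn := 1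
  rOut := 2
  rIn_pos := one_pos
  rIn_lt_rOut := one_lt_two

/-- The smooth cutoff `χ_n(x) = χ(x / (n+1))`, equal to `1` on the ball of radius `n + 1` and
supported in the ball of radius `2(n+1)`. -/
noncomputable def cutoff (n : ℕ) (x : V) : ℝ :=
  unitBump V (((n : ℝ) + 1)⁻¹ • x)

theorem cutoff_nonneg (n : ℕ) (x : V) : 0 ≤ cutoff n x :=
  (unitBump V).nonneg

theorem cutoff_le_one (n : ℕ) (x : V) : cutoff n x ≤ 1 :=
  (unitBump V).le_one

theorem abs_cutoff_le_one (n : ℕ) (x : V) : |cutoff n x| ≤ 1 :=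
  (abs_of_nonneg (cutoff_nonneg n x)).trans_le (cutoff_le_one n x)

theorem cutoff_eq_one {n : ℕ} {x : V} (hx : ‖x‖ ≤ n + 1) : cutoff n x = 1 := by
  have hn : (0 : ℝ) < n + 1 := by positivity
  refine (unitBump V).one_of_mem_closedBall ?_
  rw [mem_closedBall_zero_iff, norm_smul, norm_inv, Real.norm_of_nonneg hn.le,
    inv_mul_le_iff₀ hn]
  exact hx.trans_eq (mul_one _).symm

theorem isTestFunction_unitBump [FiniteDimensional ℝ V] : IsTestFunction (unitBump V : V → ℝ) :=
  ⟨(unitBump V).contDiff, (unitBump V).hasCompactSupport⟩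

theorem isTestFunction_cutoff [FiniteDimensional ℝ V] (n : ℕ) :
    IsTestFunction (cutoff n : V → ℝ) :=
  ⟨isTestFunction_unitBump.1.comp (contDiff_const_smul _),
    isTestFunction_unitBump.2.comp_smul (inv_ne_zero n.cast_add_one_ne_zero)⟩

theorem tendsto_cutoff (x : V) : Tendsto (fun n => cutoff n x) atTop (𝓝 1) := by
  refine tendsto_const_nhds.congr' ?_
  filter_upwards [eventually_ge_atTop ⌈‖x‖⌉₊] with n hn
  have hxn : ‖x‖ ≤ n := (Nat.le_ceil ‖x‖).trans (Nat.cast_le.2 hn)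
  rw [cutoff_eq_one (by linarith)]

theorem fderiv_cutoff (n : ℕ) (x : V) :
    fderiv ℝ (cutoff n) x =
      ((n : ℝ) + 1)⁻¹ • fderiv ℝ (unitBump V : V → ℝ) (((n : ℝ) + 1)⁻¹ • x) :=
  fderiv_comp_smul _

theorem fderiv_cutoff_eq_zero {n : ℕ} {x : V} (hx : ‖x‖ < n + 1) :
    fderiv ℝ (cutoff n) x = 0 := by
  have hloc : cutoff n =ᶠ[𝓝 x] fun _ => 1 := by
    filter_upwards [(isOpen_lt continuous_norm continuous_const).mem_nhds hx] with y hy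
    exact cutoff_eq_one (le_of_lt hy)
  rw [hloc.fderiv_eq, fderiv_const_apply]

theorem exists_norm_fderiv_cutoff_le (V : Type*) [NormedAddCommGroup V] [NormedSpace ℝ V]
    [HasContDiffBump V] [FiniteDimensional ℝ V] :
    ∃ K : ℝ, ∀ (n : ℕ) (x : V), ‖fderiv ℝ (cutoff n) x‖ ≤ K / (n + 1) := by
  obtain ⟨K, hK⟩ := (isTestFunction_unitBump.1.continuous_fderiv
    (by simp)).bounded_above_of_compact_support (isTestFunction_unitBump (V := V).2.fderiv ℝ)
  refine ⟨K, fun n x => ?_⟩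
  have hn : (0 : ℝ) < n + 1 := by positivity
  rw [fderiv_cutoff, norm_smul, norm_inv, Real.norm_of_nonneg hn.le, div_eq_inv_mul]
  gcongr
  exact hK _

theorem tendsto_integral_cutoff_mul [FiniteDimensional ℝ V] [MeasurableSpace V] [BorelSpace V]
    {μ : Measure V} {f : V → ℝ} (hf : Integrable f μ) :
    Tendsto (fun n => ∫ x, cutoff n x * f x ∂μ) atTop (𝓝 (∫ x, f x ∂μ)) := by
  refine tendsto_integral_of_dominated_convergence (fun x => ‖f x‖)
    (fun n => (isTestFunction_cutoff n).1.continuous.aestronglyMeasurable.mul hf.1) hf.norm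
    (fun n => Eventually.of_forall fun x => ?_) (Eventually.of_forall fun x => ?_)
  · rw [norm_mul]
    exact mul_le_of_le_one_left (norm_nonneg _) (abs_cutoff_le_one n x)
  · simpa only [one_mul] using (tendsto_cutoff x).mul_const (f x)

end Cutoff

/-! ### Truncations -/

/-- The nonlinearities of Bénilan and Crandall: smooth, nondecreasing, Lipschitz and bounded
functions of a real variable which vanish near the origin. -/
structure IsTruncation (β : ℝ → ℝ) : Prop where
  contDiff : ContDiff ℝ (⊤ : ℕ∞) β
  monotone : Monotone β
  lipschitz : ∃ K, LipschitzWith K β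
  bounded : ∃ C, ∀ r, |β r| ≤ C
  eventually_eq_zero : ∀ᶠ r in 𝓝 0, β r = 0

section Truncation

variable {α : Type*} [MeasurableSpace α] {μ : Measure α} {β : ℝ → ℝ} {v : α → ℝ} {q : ℝ≥0∞}

theorem IsTruncation.map_zero (hβ : IsTruncation β) : β 0 = 0 :=
  hβ.eventually_eq_zero.self_of_nhds

theorem IsTruncation.memLp_comp (hβ : IsTruncation β) (hv : MemLp v q μ) :
    MemLp (fun x => β (v x)) q μ :=
  hβ.lipschitz.choose_spec.comp_memLp hβ.map_zero hv

theorem IsTruncation.memLp_comp_of_memLp (hβ : IsTruncation β) (hv : MemLp v q μ) (hq : q ≠ 0)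
    (hq' : q ≠ ∞) (r : ℝ≥0∞) : MemLp (fun x => β (v x)) r μ := by
  obtain ⟨C, hC⟩ := hβ.bounded
  obtain ⟨ε, hε, hβε⟩ := Metric.eventually_nhds_iff.1 hβ.eventually_eq_zero
  have hfin : μ {x | ε.toNNReal ≤ ‖v x‖₊} < ∞ :=
    hv.meas_ge_lt_top hq hq' (Real.toNNReal_pos.2 hε).ne'
  refine MemLp.mono_exponent_of_measure_support_ne_top (memLp_top_of_bound
    (hβ.contDiff.continuous.comp_aestronglyMeasurable hv.1) C
    (Eventually.of_forall fun x => hC (v x))) (fun x hx => hβε ?_) hfin.ne le_top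
  rw [dist_zero_right]
  exact Real.lt_toNNReal_iff_coe_lt.1 (not_le.1 hx)

theorem IsTruncation.neg_comp_neg (hβ : IsTruncation β) : IsTruncation fun r => -β (-r) where
  contDiff := (hβ.contDiff.comp contDiff_neg).neg
  monotone := fun _ _ h => neg_le_neg (hβ.monotone (neg_le_neg h))
  lipschitz := hβ.lipschitz.imp fun K hK => (hK.comp LipschitzWith.id.neg).neg.weaken (by simp)
  bounded := hβ.bounded.imp fun C hC r => (abs_neg _).trans_le (hC _)
  eventually_eq_zero := by
    have hneg : Tendsto (fun r : ℝ => -r) (𝓝 0) (𝓝 0) := by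
      simpa only [neg_zero] using (continuous_neg (G := ℝ)).tendsto 0
    exact (hneg.eventually hβ.eventually_eq_zero).mono fun r hr => by rw [hr, neg_zero]

end Truncation

/-! ### The flux `|∇v|^{p-2} ∇v` -/

section Flux

variable {E : Type*} [NormedAddCommGroup E] [NormedSpace ℝ E] {p : ℝ}

theorem norm_rpow_sub_two_smul (hp : 1 < p) (g : E) : ‖‖g‖ ^ (p - 2) • g‖ = ‖g‖ ^ (p - 1) := by
  rw [norm_smul, Real.norm_of_nonneg (by positivity)]
  obtain rfl | hg := eq_or_ne g 0
  · simp only [norm_zero, mul_zero, Real.zero_rpow (sub_pos.2 hp).ne']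
  · rw [← Real.rpow_add_one (norm_ne_zero_iff.2 hg)]
    ring_nf

theorem memLp_norm_rpow_sub_two_smul {α : Type*} [MeasurableSpace α] {μ : Measure α} (hp : 1 < p)
    {G : α → E} (hG : MemLp G (ENNReal.ofReal p) μ) :
    MemLp (fun x => ‖G x‖ ^ (p - 2) • G x) (ENNReal.ofReal p.conjExponent) μ := by
  have hpow := hG.norm_rpow_div (ENNReal.ofReal (p - 1))
  rw [← ENNReal.ofReal_div_of_pos (sub_pos.2 hp),
    ENNReal.toReal_ofReal (sub_pos.2 hp).le] at hpow
  refine hpow.mono ((hG.1.norm.aemeasurable.pow_const _).aestronglyMeasurable.smul hG.1)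
    (Eventually.of_forall fun x => ?_)
  rw [norm_rpow_sub_two_smul hp]
  exact le_abs_self _

theorem ofReal_holderConjugate_conjExponent (hp : 1 < p) :
    (ENNReal.ofReal p).HolderConjugate (ENNReal.ofReal p.conjExponent) :=
  (Real.HolderConjugate.conjExponent hp).ennrealOfReal

end Flux

/-! ### Accretivity -/

section IntegrationByParts

theorem tendsto_integral_mul_of_norm_le {α : Type*} [MeasurableSpace α] {μ : Measure α}
    {a : ℕ → α → ℝ} {b : α → ℝ} {g : ℕ → α → ℝ} {h : α → ℝ} {C : ℝ}
    (ha : ∀ n, AEStronglyMeasurable (a n) μ) (hC : ∀ n x, ‖a n x‖ ≤ C)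
    (hab : ∀ᵐ x ∂μ, Tendsto (fun n => a n x) atTop (𝓝 (b x)))
    (hg : ∀ n, Integrable (g n) μ) (hh : Integrable h μ)
    (hgh : Tendsto (fun n => eLpNorm (g n - h) 1 μ) atTop (𝓝 0)) :
    Tendsto (fun n => ∫ x, a n x * g n x ∂μ) atTop (𝓝 (∫ x, b x * h x ∂μ)) := by
  have hfix : Tendsto (fun n => ∫ x, a n x * h x ∂μ) atTop (𝓝 (∫ x, b x * h x ∂μ)) := by
    refine tendsto_integral_of_dominated_convergence (fun x => C * ‖h x‖)
      (fun n => (ha n).mul hh.1) (hh.norm.const_mul C)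
      (fun n => Eventually.of_forall fun x => ?_) (hab.mono fun x hx => hx.mul_const _)
    rw [norm_mul]
    exact mul_le_mul_of_nonneg_right (hC n x) (norm_nonneg _)
  have hdiff_int : ∀ n, Integrable (fun x => a n x * (g n - h) x) μ := fun n =>
    ((hg n).sub hh).bdd_mul (ha n) (Eventually.of_forall (hC n))
  have hdiff : Tendsto (fun n => ∫ x, a n x * (g n - h) x ∂μ) atTop (𝓝 0) := by
    have hlim := ENNReal.Tendsto.const_mul (a := ENNReal.ofReal C) hgh
      (Or.inr ENNReal.ofReal_ne_top)
    rw [mul_zero] at hlim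
    simpa only [integral_zero] using tendsto_integral_of_L1' (fun _ => (0 : ℝ))
      aestronglyMeasurable_const (Eventually.of_forall hdiff_int)
      (tendsto_of_tendsto_of_tendsto_of_le_of_le tendsto_const_nhds hlim (fun _ => zero_le)
        fun n => eLpNorm_le_mul_eLpNorm_of_ae_le_mul (Eventually.of_forall fun x => by
          rw [Pi.sub_apply, sub_zero, norm_mul]
          exact mul_le_mul_of_nonneg_right (hC n x) (norm_nonneg _)) 1)
  have hsum := hdiff.add hfix
  rw [zero_add] at hsum
  refine hsum.congr fun n => ?_
  rw [← integral_add (hdiff_int n) (hh.bdd_mul (ha n) (Eventually.of_forall (hC n)))]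
  simp only [← mul_add, Pi.sub_apply, sub_add_cancel]

theorem tendsto_eLpNorm_inner_sub {α E : Type*} [MeasurableSpace α] {μ : Measure α}
    [NormedAddCommGroup E] [InnerProductSpace ℝ E] {p q : ℝ≥0∞} [p.HolderConjugate q]
    {g : ℕ → α → E} {h F : α → E} (hg : ∀ n, AEStronglyMeasurable (g n) μ)
    (hh : AEStronglyMeasurable h μ) (hF : MemLp F q μ)
    (hgh : Tendsto (fun n => eLpNorm (g n - h) p μ) atTop (𝓝 0)) :
    Tendsto (fun n => eLpNorm ((fun x => inner ℝ (g n x) (F x)) - fun x => inner ℝ (h x) (F x))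
      1 μ) atTop (𝓝 0) := by
  have hlim := ENNReal.Tendsto.mul_const hgh (Or.inr hF.2.ne)
  rw [zero_mul] at hlim
  refine tendsto_of_tendsto_of_tendsto_of_le_of_le tendsto_const_nhds hlim (fun _ => zero_le)
    fun n => ?_
  have hHolder := eLpNorm_le_eLpNorm_mul_eLpNorm_of_nnnorm (p := p) (q := q) (r := 1)
    ((hg n).sub hh) hF.1 (inner ℝ) 1
    (Eventually.of_forall fun x => by simpa using nnnorm_inner_le_nnnorm (𝕜 := ℝ) _ (F x))
  simpa only [Pi.sub_def, inner_sub_left, ENNReal.coe_one, one_mul] using hHolder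

theorem memLp_fderiv_of_isTestFunction {V : Type*} [NormedAddCommGroup V] [NormedSpace ℝ V]
    [MeasurableSpace V] [BorelSpace V] {μ : Measure V}
    [IsFiniteMeasureOnCompacts μ] {φ : V → ℝ} (hφ : IsTestFunction φ) (q : ℝ≥0∞) :
    MemLp (fderiv ℝ φ) q μ :=
  (hφ.1.continuous_fderiv (by simp)).memLp_of_hasCompactSupport (hφ.2.fderiv ℝ)

variable {d : ℕ} {v : Space d → ℝ} {G : Space d → Space d}

theorem HasWeakGradient.fderiv_mollify_apply (hv : HasWeakGradient v G) (n : ℕ)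
    (x y : Space d) :
    fderiv ℝ (mollify volume n v) x y = inner ℝ (mollify volume n G x) y := by
  have htest : IsTestFunction fun z => (stdBump (Space d) n).normed volume (x - z) :=
    ⟨(stdBump (Space d) n).contDiff_normed.comp (contDiff_const.sub contDiff_id),
      hasCompactSupport_normed_const_sub n x⟩
  have hweak := hv.2.2 _ htest y
  simp only [mul_comm (v _)] at hweak
  rw [PLaplace.fderiv_mollify_apply (w := fun z => inner ℝ (G z) y) hv.1 hweak, mollify_apply,
    mollify_apply, real_inner_comm,
    ← integral_inner (integrable_normed_const_sub_smul hv.2.1 n x)]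
  simp only [inner_smul_right, real_inner_comm, smul_eq_mul]

theorem HasWeakGradient.fderiv_mul_comp_mollify_apply (hv : HasWeakGradient v G) {β : ℝ → ℝ}
    (hβ : Differentiable ℝ β) {χ : Space d → ℝ} (hχ : Differentiable ℝ χ) (n : ℕ)
    (x y : Space d) :
    fderiv ℝ (fun x => χ x * β (mollify volume n v x)) x y =
      χ x * deriv β (mollify volume n v x) * inner ℝ (mollify volume n G x) y +
        β (mollify volume n v x) * fderiv ℝ χ x y := by
  have hmollify := ((contDiff_mollify hv.1 n).differentiable (by simp) x).hasFDerivAt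
  have hcomp := (hβ (mollify volume n v x)).hasDerivAt.comp_hasFDerivAt x hmollify
  have hprod : HasFDerivAt (fun x => χ x * β (mollify volume n v x)) _ x :=
    (hχ x).hasFDerivAt.mul hcomp
  rw [hprod.fderiv]
  simp only [add_apply, smul_apply, smul_eq_mul, hv.fderiv_mollify_apply]
  ring

variable {p q : ℝ≥0∞} [p.HolderConjugate q] {F : Space d → Space d} {f : Space d → ℝ}
  {β : ℝ → ℝ} {K : ℝ≥0} {C : ℝ} {χ : Space d → ℝ}

theorem HasWeakDivergence.integral_mul_comp_mollify (hF : HasWeakDivergence F f)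
    (hFq : MemLp F q) (hv : HasWeakGradient v G) (hp : p ≠ ∞) (hG : MemLp G p)
    (hβ : ContDiff ℝ (⊤ : ℕ∞) β) (hK : LipschitzWith K β) (hC : ∀ r, |β r| ≤ C)
    (hχ : IsTestFunction χ) (n : ℕ) :
    (∫ x, χ x * deriv β (mollify volume n v x) * inner ℝ (mollify volume n G x) (F x)) +
        ∫ x, β (mollify volume n v x) * fderiv ℝ χ x (F x) =
      -∫ x, β (mollify volume n v x) * (χ x * f x) := by
  have hsmooth := contDiff_mollify hv.1 n
  have htest : IsTestFunction fun x => χ x * β (mollify volume n v x) :=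
    ⟨hχ.1.mul (hβ.comp hsmooth), hχ.2.mul_right⟩
  obtain ⟨B, hB⟩ := hχ.1.continuous.bounded_above_of_compact_support hχ.2
  have hGn := memLp_mollify (ENNReal.HolderConjugate.one_le p q) hp hG n
  rw [← integral_add]
  · simpa only [hv.fderiv_mul_comp_mollify_apply (hβ.differentiable (by simp))
      (hχ.1.differentiable (by simp)), mul_left_comm (β _), mul_assoc] using hF.2.2 _ htest
  · refine (memLp_one_iff_integrable.1 (memLp_of_bilin 1 (innerSL ℝ) hGn hFq)).bdd_mul (c := B * K)
      (hχ.1.continuous.mul ((hβ.continuous_deriv (by simp)).comp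
        hsmooth.continuous)).aestronglyMeasurable (Eventually.of_forall fun x => ?_)
    rw [norm_mul]
    exact mul_le_mul (hB x) (norm_deriv_le_of_lipschitz hK) (norm_nonneg _)
      ((norm_nonneg _).trans (hB x))
  · exact (memLp_one_iff_integrable.1 (memLp_of_bilin 1 (.id ℝ _)
      (memLp_fderiv_of_isTestFunction hχ p) hFq)).bdd_mul
      (hβ.continuous.comp hsmooth.continuous).aestronglyMeasurable
      (Eventually.of_forall fun x => hC _)

theorem HasWeakDivergence.integral_mul_comp (hF : HasWeakDivergence F f)
    (hFq : MemLp F q) (hv : HasWeakGradient v G) (hp : p ≠ ∞) (hG : MemLp G p)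
    (hβ : ContDiff ℝ (⊤ : ℕ∞) β) (hK : LipschitzWith K β) (hC : ∀ r, |β r| ≤ C)
    (hχ : IsTestFunction χ) :
    (∫ x, χ x * deriv β (v x) * inner ℝ (G x) (F x)) + ∫ x, β (v x) * fderiv ℝ χ x (F x) =
      -∫ x, β (v x) * (χ x * f x) := by
  have hp1 : 1 ≤ p := ENNReal.HolderConjugate.one_le p q
  have hsmooth n := (contDiff_mollify hv.1 n).continuous
  have hβ' : Continuous (deriv β) := hβ.continuous_deriv (by simp)
  have hae := ae_tendsto_mollify hv.1
  obtain ⟨B, hB⟩ := hχ.1.continuous.bounded_above_of_compact_support hχ.2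
  have hβv : ∀ᵐ x, Tendsto (fun n => β (mollify volume n v x)) atTop (𝓝 (β (v x))) :=
    hae.mono fun x hx => (hβ.continuous.tendsto _).comp hx
  have hlim_test : ∀ g : Space d → ℝ, Integrable g →
      Tendsto (fun n => ∫ x, β (mollify volume n v x) * g x) atTop (𝓝 (∫ x, β (v x) * g x)) :=
    fun g hg => tendsto_integral_mul_of_norm_le
      (fun n => (hβ.continuous.comp (hsmooth n)).aestronglyMeasurable) (fun n x => hC _) hβv
      (fun _ => hg) hg (by simp)
  have hlim_inner : Tendsto (fun n => ∫ x, χ x * deriv β (mollify volume n v x) *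
      inner ℝ (mollify volume n G x) (F x)) atTop
      (𝓝 (∫ x, χ x * deriv β (v x) * inner ℝ (G x) (F x))) := by
    refine tendsto_integral_mul_of_norm_le (C := B * K)
      (fun n => (hχ.1.continuous.mul (hβ'.comp (hsmooth n))).aestronglyMeasurable)
      (fun n x => ?_) (hae.mono fun x hx => ((hβ'.tendsto _).comp hx).const_mul _)
      (fun n => memLp_one_iff_integrable.1
        (memLp_of_bilin 1 (innerSL ℝ) (memLp_mollify hp1 hp hG n) hFq))
      (memLp_one_iff_integrable.1 (memLp_of_bilin 1 (innerSL ℝ) hG hFq))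
      (tendsto_eLpNorm_inner_sub (p := p) (fun n => (memLp_mollify hp1 hp hG n).1) hG.1 hFq
        (tendsto_eLpNorm_mollify_sub hp1 hp hG))
    rw [norm_mul]
    exact mul_le_mul (hB x) (norm_deriv_le_of_lipschitz hK) (norm_nonneg _)
      ((norm_nonneg _).trans (hB x))
  have hdχF : Integrable fun x => fderiv ℝ χ x (F x) := memLp_one_iff_integrable.1
    (memLp_of_bilin 1 (.id ℝ _) (memLp_fderiv_of_isTestFunction hχ p) hFq)
  have hχf : Integrable fun x => χ x * f x :=
    hF.2.1.integrable_smul_left_of_hasCompactSupport hχ.1.continuous hχ.2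
  exact tendsto_nhds_unique (hlim_inner.add (hlim_test _ hdχF)) ((hlim_test _ hχf).neg.congr
    fun n => (hF.integral_mul_comp_mollify hFq hv hp hG hβ hK hC hχ n).symm)

theorem tendsto_integral_mul_fderiv_cutoff {w : Space d → ℝ} (hw : MemLp w p) (hF : MemLp F q) :
    Tendsto (fun n => ∫ x, w x * fderiv ℝ (cutoff n) x (F x)) atTop (𝓝 0) := by
  obtain ⟨K, hK⟩ := exists_norm_fderiv_cutoff_le (Space d)
  have hwF : Integrable fun x => ‖w x‖ * ‖F x‖ := hw.norm.integrable_mul hF.norm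
  have hbound (n : ℕ) (x : Space d) :
      ‖w x * fderiv ℝ (cutoff n) x (F x)‖ ≤ K / (n + 1) * (‖w x‖ * ‖F x‖) := by
    rw [norm_mul, mul_left_comm]
    gcongr
    exact le_of_opNorm_le _ (hK n x) _
  refine squeeze_zero_norm (fun n => norm_integral_le_of_norm_le (hwF.const_mul _)
    (Eventually.of_forall (hbound n))) ?_
  simp only [integral_const_mul]
  simpa only [mul_one_div, mul_zero, zero_mul] using ((tendsto_one_div_add_atTop_nhds_zero_nat
    (𝕜 := ℝ)).const_mul K).mul_const (∫ x, ‖w x‖ * ‖F x‖)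

theorem IsTruncation.integral_mul_divergence_nonpos (hβ : IsTruncation β)
    (hF : HasWeakDivergence F f) (hFq : MemLp F q) (hv : HasWeakGradient v G) (hp : p ≠ ∞)
    (hG : MemLp G p) (hGF : ∀ x, 0 ≤ inner ℝ (G x) (F x)) (hβv : MemLp (fun x => β (v x)) p)
    (hβf : Integrable fun x => β (v x) * f x) : ∫ x, β (v x) * f x ≤ 0 := by
  obtain ⟨K, hK⟩ := hβ.lipschitz
  obtain ⟨C, hC⟩ := hβ.bounded
  have hcutoff (n : ℕ) : ∫ x, cutoff n x * (β (v x) * f x) ≤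
      -∫ x, β (v x) * fderiv ℝ (cutoff n) x (F x) := by
    have hparts := hF.integral_mul_comp hFq hv hp hG hβ.contDiff hK hC (isTestFunction_cutoff n)
    have hnonneg : 0 ≤ ∫ x, cutoff n x * deriv β (v x) * inner ℝ (G x) (F x) :=
      integral_nonneg fun x => mul_nonneg
        (mul_nonneg (cutoff_nonneg n x) hβ.monotone.deriv_nonneg) (hGF x)
    simp only [mul_left_comm (cutoff n _)]
    linarith
  refine le_of_tendsto_of_tendsto' (tendsto_integral_cutoff_mul hβf) ?_ hcutoff
  simpa only [neg_zero] using (tendsto_integral_mul_fderiv_cutoff hβv hFq).neg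

theorem IsNegPLaplacian.integral_truncation_mul_nonneg {p : ℝ} (hp : 1 < p) {v f : L2 d}
    (h : IsNegPLaplacian p v f) (hβ : IsTruncation β) : 0 ≤ ∫ x, β (v x) * f x := by
  obtain ⟨G, hG, hv, hdiv⟩ := h
  have := ofReal_holderConjugate_conjExponent hp
  have hvm := Lp.memLp v
  have hβf : Integrable fun x => β (v x) * -f x :=
    (hβ.memLp_comp hvm).integrable_mul (Lp.memLp f).neg
  have hle := hβ.integral_mul_divergence_nonpos hdiv (memLp_norm_rpow_sub_two_smul hp hG) hv
    ENNReal.ofReal_ne_top hG (fun x => ?_)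
    (hβ.memLp_comp_of_memLp hvm two_ne_zero ENNReal.ofNat_ne_top _) hβf
  · simpa only [mul_neg, integral_neg, neg_nonpos] using hle
  · rw [inner_smul_right, real_inner_self_eq_norm_sq]
    positivity

end IntegrationByParts

/-! ### Energies -/

section Energy

variable {β : ℝ → ℝ} {K : ℝ≥0}

/-- The primitive of `β` vanishing at the origin. -/
noncomputable def primitive (β : ℝ → ℝ) (r : ℝ) : ℝ :=
  ∫ s in (0 : ℝ)..r, β s

theorem primitive_zero : primitive β 0 = 0 :=
  intervalIntegral.integral_same

theorem hasDerivAt_primitive (hβ : Continuous β) (r : ℝ) : HasDerivAt (primitive β) (β r) r :=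
  (hβ.integral_hasStrictDerivAt 0 r).hasDerivAt

theorem continuous_primitive (hβ : Continuous β) : Continuous (primitive β) :=
  continuous_iff_continuousAt.2 fun r => (hasDerivAt_primitive hβ r).continuousAt

theorem abs_primitive_sub_le (hβ : LipschitzWith K β) (a b : ℝ) :
    |primitive β a - primitive β b - β b * (a - b)| ≤ K * (a - b) ^ 2 := by
  have hderiv : ∀ r ∈ uIcc b a, HasDerivWithinAt (fun r => primitive β r - β b * r) (β r - β b)
      (uIcc b a) r := fun r _ => by
    have h := (hasDerivAt_primitive hβ.continuous r).sub ((hasDerivAt_id r).const_mul (β b))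
    rw [mul_one] at h
    exact h.hasDerivWithinAt
  have hbound : ∀ r ∈ uIcc b a, ‖β r - β b‖ ≤ K * |a - b| := fun r hr =>
    (hβ.dist_le_mul r b).trans
      (mul_le_mul_of_nonneg_left (abs_sub_left_of_mem_uIcc hr) K.coe_nonneg)
  have hmean := Convex.norm_image_sub_le_of_norm_hasDerivWithin_le hderiv hbound
    (convex_uIcc b a) left_mem_uIcc right_mem_uIcc
  rw [Real.norm_eq_abs, Real.norm_eq_abs, mul_assoc, ← pow_two, sq_abs] at hmean
  convert hmean using 2
  ring

theorem abs_primitive_le (hβ : LipschitzWith K β) (h0 : β 0 = 0) (r : ℝ) :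
    |primitive β r| ≤ K * r ^ 2 := by
  simpa only [primitive_zero, h0, sub_zero, zero_mul] using abs_primitive_sub_le hβ r 0

variable {α : Type*} [MeasurableSpace α] {μ : Measure α}

/-- The functional `v ↦ ∫ j(v)`, where `j` is the primitive of `β`; it is convex when `β` is
nondecreasing. -/
noncomputable def energy (μ : Measure α) (β : ℝ → ℝ) (v : α → ℝ) : ℝ :=
  ∫ x, primitive β (v x) ∂μ

theorem integrable_primitive_comp (hβ : LipschitzWith K β) (h0 : β 0 = 0) {v : α → ℝ}
    (hv : MemLp v 2 μ) : Integrable (fun x => primitive β (v x)) μ :=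
  (hv.integrable_sq.const_mul (K : ℝ)).mono'
    ((continuous_primitive hβ.continuous).comp_aestronglyMeasurable hv.1)
    (Eventually.of_forall fun x => abs_primitive_le hβ h0 (v x))

theorem inner_compLp_eq_integral (hβ : LipschitzWith K β) (h0 : β 0 = 0) (v f : Lp ℝ 2 μ) :
    inner ℝ (hβ.compLp h0 v) f = ∫ x, β (v x) * f x ∂μ := by
  rw [L2.inner_def]
  refine integral_congr_ae ?_
  filter_upwards [hβ.coeFn_compLp h0 v] with x hx
  rw [hx, Real.inner_apply, Function.comp_apply]

theorem integral_sq_eq_norm_sq (v : Lp ℝ 2 μ) : ∫ x, v x ^ 2 ∂μ = ‖v‖ ^ 2 := by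
  rw [← real_inner_self_eq_norm_sq, L2.inner_def]
  simp only [Real.inner_apply, pow_two]

theorem abs_energy_sub_le (hβ : LipschitzWith K β) (h0 : β 0 = 0) (w v : Lp ℝ 2 μ) :
    |energy μ β w - energy μ β v - inner ℝ (hβ.compLp h0 v) (w - v)| ≤ K * ‖w - v‖ ^ 2 := by
  have hw := Lp.memLp w
  have hv := Lp.memLp v
  have hjw := integrable_primitive_comp hβ h0 hw
  have hjv := integrable_primitive_comp hβ h0 hv
  have hj : Integrable (fun x => primitive β (w x) - primitive β (v x)) μ := hjw.sub hjv
  have hβd : Integrable (fun x => β (v x) * (w - v : Lp ℝ 2 μ) x) μ :=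
    (hβ.comp_memLp h0 hv).integrable_mul (Lp.memLp (w - v))
  rw [inner_compLp_eq_integral, ← integral_sq_eq_norm_sq, ← integral_const_mul, energy, energy,
    ← integral_sub hjw hjv, ← integral_sub hj hβd, ← Real.norm_eq_abs]
  refine norm_integral_le_of_norm_le ((Lp.memLp (w - v)).integrable_sq.const_mul (K : ℝ)) ?_
  filter_upwards [Lp.coeFn_sub w v] with x hx
  rw [hx]
  exact abs_primitive_sub_le hβ (w x) (v x)

theorem hasGradientAt_energy (hβ : LipschitzWith K β) (h0 : β 0 = 0) (v : Lp ℝ 2 μ) :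
    HasGradientAt (fun w : Lp ℝ 2 μ => energy μ β w) (hβ.compLp h0 v) v := by
  rw [hasGradientAt_iff_isLittleO]
  have hquadratic : (fun w : Lp ℝ 2 μ => energy μ β w - energy μ β v -
      inner ℝ (hβ.compLp h0 v) (w - v)) =O[𝓝 v] fun w => ‖w - v‖ ^ 2 :=
    Asymptotics.IsBigO.of_bound K (Eventually.of_forall fun w => by
      rw [norm_pow, norm_norm]
      exact abs_energy_sub_le hβ h0 w v)
  exact hquadratic.trans_isLittleO
    ((Asymptotics.isLittleO_norm_pow_id one_lt_two).comp_tendsto (tendsto_sub_nhds_zero_iff.2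
      tendsto_id))

theorem dist_energy_le (hβ : LipschitzWith K β) (h0 : β 0 = 0) {M : ℝ} {w v : Lp ℝ 2 μ}
    (hw : ‖w‖ ≤ M) (hv : ‖v‖ ≤ M) :
    dist (energy μ β w) (energy μ β v) ≤ K * M * dist w v := by
  rw [dist_eq_norm, dist_eq_norm]
  refine Convex.norm_image_sub_le_of_norm_hasFDerivWithin_le (𝕜 := ℝ)
    (f := fun w : Lp ℝ 2 μ => energy μ β w)
    (fun z _ => (hasGradientAt_energy hβ h0 z).hasFDerivAt.hasFDerivWithinAt) (fun z hz => ?_)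
    (convex_closedBall 0 M) (mem_closedBall_zero_iff.2 hv) (mem_closedBall_zero_iff.2 hw)
  rw [LinearIsometryEquiv.norm_map]
  exact (hβ.norm_compLp_le h0 z).trans
    (mul_le_mul_of_nonneg_left (mem_closedBall_zero_iff.1 hz) K.coe_nonneg)

variable {d : ℕ} {p T : ℝ} {u₀ : L2 d} {u : ℝ → L2 d}

theorem IsWeakSolution.absolutelyContinuousOnInterval (hu : IsWeakSolution p T u₀ u) {s t : ℝ}
    (hs : s ∈ Ioo 0 T) (ht : t ∈ Ioo 0 T) : AbsolutelyContinuousOnInterval u s t := by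
  obtain ⟨δ, hδ, hδst⟩ := exists_between (lt_min hs.1 ht.1)
  have hδs := hδst.trans_le (min_le_left s t)
  exact (hu.memW12 δ hδ (hδs.trans hs.2)).absolutelyContinuousOnInterval
    (hu.continuousOn.mono fun r hr => ⟨(hδ.trans hr.1).le, hr.2.le⟩) ⟨hδs, hs.2⟩
    ⟨hδst.trans_le (min_le_right s t), ht.2⟩

theorem IsWeakSolution.energy_le (hp : 1 < p) (hu : IsWeakSolution p T u₀ u)
    (hβ : IsTruncation β) {t : ℝ} (ht : t ∈ Icc 0 T) :
    energy volume β (u t) ≤ energy volume β u₀ := by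
  obtain ⟨K, hK⟩ := hβ.lipschitz
  obtain ⟨M, hM⟩ := isCompact_Icc.exists_bound_of_continuousOn hu.continuousOn
  obtain ⟨a, -, ha⟩ := hu.equation
  have hgrad := hasGradientAt_energy (μ := (volume : Measure (Space d))) hK hβ.map_zero
  have hcont : ContinuousOn (fun s => energy volume β (u s)) (Icc 0 t) :=
    (continuous_iff_continuousAt.2 fun v => (hgrad v).continuousAt).comp_continuousOn
      (hu.continuousOn.mono (Icc_subset_Icc_right ht.2))
  have hsub : Ioo 0 t ⊆ Ioo 0 T := Ioo_subset_Ioo_right ht.2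
  have hac : ∀ r ∈ Ioo 0 t, ∀ s ∈ Ioo 0 t,
      AbsolutelyContinuousOnInterval (fun s => energy volume β (u s)) r s := fun r hr s hs =>
    absolutelyContinuousOnInterval_of_dist_le_mul
      (hu.absolutelyContinuousOnInterval (hsub hr) (hsub hs)) fun x hx y hy =>
        have hIcc := (ordConnected_Ioo.uIcc_subset (hsub hr) (hsub hs)).trans Ioo_subset_Icc_self
        dist_energy_le hK hβ.map_zero (hM x (hIcc hx)) (hM y (hIcc hy))
  have hdissipation : ∀ᵐ s ∂(volume.restrict (Ioo 0 t)),
      ∃ e ≤ 0, HasDerivAt (fun s => energy volume β (u s)) e s := by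
    filter_upwards [ae_restrict_of_ae_restrict_of_subset hsub ha] with s ⟨hAs, hus⟩
    refine ⟨_, ?_, (hgrad (u s)).hasFDerivAt.comp_hasDerivAt s hus⟩
    rw [map_neg, neg_nonpos, InnerProductSpace.toDual_apply_apply, inner_compLp_eq_integral]
    exact hAs.integral_truncation_mul_nonneg hp hβ
  simpa only [hu.initial, intervalIntegral.integral_zero, sub_nonpos] using
    sub_le_integral_of_locally_absolutelyContinuous ht.1 hcont hac
      (h := fun _ => 0) IntervalIntegrable.zero hdissipation

end Energy

/-! ### Domination -/

section Domination

/-- A smooth step, equal to `0` on `(-∞, m]` and to `1` on `[2m, ∞)` for `m > 0`; its primitive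
approximates the positive part as `m → 0`. -/
noncomputable def step (m r : ℝ) : ℝ :=
  Real.smoothTransition (m⁻¹ * r - 1)

variable {m : ℝ}

theorem step_nonneg (m r : ℝ) : 0 ≤ step m r :=
  Real.smoothTransition.nonneg _

theorem step_le_one (m r : ℝ) : step m r ≤ 1 :=
  Real.smoothTransition.le_one _

theorem step_eq_zero (hm : 0 < m) {r : ℝ} (hr : r ≤ m) : step m r = 0 := by
  refine Real.smoothTransition.zero_of_nonpos ?_
  rwa [sub_nonpos, inv_mul_le_iff₀ hm, mul_one]

theorem step_pos (hm : 0 < m) {r : ℝ} (hr : m < r) : 0 < step m r := by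
  refine Real.smoothTransition.pos_of_pos ?_
  rwa [sub_pos, lt_inv_mul_iff₀ hm, mul_one]

theorem step_eq_one (hm : 0 < m) {r : ℝ} (hr : 2 * m ≤ r) : step m r = 1 := by
  refine Real.smoothTransition.one_of_one_le ?_
  rw [le_sub_iff_add_le, le_inv_mul_iff₀ hm]
  linarith

theorem contDiff_step (m : ℝ) : ContDiff ℝ (⊤ : ℕ∞) (step m) :=
  Real.smoothTransition.contDiff.comp ((contDiff_const.mul contDiff_id).sub contDiff_const)

theorem continuous_step (m : ℝ) : Continuous (step m) :=
  (contDiff_step m).continuous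

theorem exists_lipschitzWith_smoothTransition :
    ∃ K, LipschitzWith K Real.smoothTransition := by
  obtain ⟨K, hK⟩ := LocallyLipschitzOn.exists_lipschitzOnWith_of_compact
    (isCompact_Icc (a := (0 : ℝ)) (b := 1))
    (Real.smoothTransition.contDiff (n := 1)).locallyLipschitz.locallyLipschitzOn
  have hproj : (Icc (0 : ℝ) 1).domRestrict Real.smoothTransition ∘ projIcc 0 1 zero_le_one =
      Real.smoothTransition := funext fun _ => Real.smoothTransition.projIcc
  exact ⟨_, hproj ▸ hK.to_restrict.comp (LipschitzWith.projIcc zero_le_one)⟩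

theorem isTruncation_step (hm : 0 < m) : IsTruncation (step m) where
  contDiff := contDiff_step m
  monotone r s hrs := Real.smoothTransition.monotone (by gcongr)
  lipschitz := by
    obtain ⟨K, hK⟩ := exists_lipschitzWith_smoothTransition
    have hlin : LipschitzWith ‖m⁻¹‖₊ fun r : ℝ => m⁻¹ * r - 1 :=
      LipschitzWith.of_dist_le_mul fun r s => by
        rw [dist_sub_right, Real.dist_eq, ← mul_sub, abs_mul, Real.dist_eq, coe_nnnorm,
          Real.norm_eq_abs]
    exact ⟨_, hK.comp hlin⟩
  bounded := ⟨1, fun r => (abs_of_nonneg (step_nonneg m r)).trans_le (step_le_one m r)⟩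
  eventually_eq_zero := by
    filter_upwards [Iio_mem_nhds hm] with r hr
    exact step_eq_zero hm (le_of_lt hr)

theorem primitive_step_eq_zero (hm : 0 < m) {r : ℝ} (hr : r ≤ m) : primitive (step m) r = 0 := by
  rw [primitive, intervalIntegral.integral_congr (g := fun _ => 0), intervalIntegral.integral_zero]
  exact fun s hs => step_eq_zero hm (hs.2.trans (max_le hm.le hr))

theorem primitive_step_nonneg (hm : 0 < m) (r : ℝ) : 0 ≤ primitive (step m) r := by
  rcases le_total r m with h | h
  · exact (primitive_step_eq_zero hm h).ge
  · exact intervalIntegral.integral_nonneg (hm.le.trans h) fun s _ => step_nonneg m s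

theorem primitive_step_le (hm : 0 < m) (r : ℝ) : primitive (step m) r ≤ max r 0 := by
  rcases le_total r m with h | h
  · exact (primitive_step_eq_zero hm h).trans_le (le_max_right r 0)
  · have hle := intervalIntegral.integral_mono_on (μ := volume) (hm.le.trans h)
      ((continuous_step m).intervalIntegrable 0 r) intervalIntegrable_const
      fun s _ => step_le_one m s
    rw [integral_one, sub_zero] at hle
    exact hle.trans (le_max_left r 0)

theorem sub_le_primitive_step (hm : 0 < m) (r : ℝ) : r - 2 * m ≤ primitive (step m) r := by
  rcases le_total r (2 * m) with h | h
  · exact (sub_nonpos.2 h).trans (primitive_step_nonneg hm r)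
  · have hint := fun a b => (continuous_step m).intervalIntegrable (μ := volume) a b
    have htail : ∫ s in (2 * m)..r, step m s = r - 2 * m := by
      rw [intervalIntegral.integral_congr (g := fun _ => 1), integral_one]
      intro s hs
      rw [uIcc_of_le h] at hs
      exact step_eq_one hm hs.1
    rw [primitive, ← intervalIntegral.integral_add_adjacent_intervals (hint 0 (2 * m))
      (hint (2 * m) r), htail]
    exact le_add_of_nonneg_left (primitive_step_nonneg hm (2 * m))

theorem primitive_step_pos (hm : 0 < m) {r : ℝ} (hr : m < r) : 0 < primitive (step m) r :=
  intervalIntegral.integral_pos (hm.trans hr) (continuous_step m).continuousOn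
    (fun s _ => step_nonneg m s) ⟨r, right_mem_Icc.2 (hm.trans hr).le, step_pos hm hr⟩

theorem primitive_neg_comp_neg (β : ℝ → ℝ) (r : ℝ) :
    primitive (fun s => -β (-s)) r = primitive β (-r) := by
  rw [primitive, primitive, intervalIntegral.integral_neg, intervalIntegral.integral_comp_neg,
    neg_zero, ← intervalIntegral.integral_symm]

variable {α : Type*} [MeasurableSpace α] {μ : Measure α} {a b : α → ℝ}

/-- Domination `b ≪ a` in the sense of Bénilan and Crandall: `∫ j(b) ≤ ∫ j(a)` for the
primitives `j` of all truncations. -/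
def IsDominatedBy (μ : Measure α) (b a : α → ℝ) : Prop :=
  ∀ β, IsTruncation β → energy μ β b ≤ energy μ β a

namespace IsDominatedBy

theorem neg (h : IsDominatedBy μ b a) : IsDominatedBy μ (-b) (-a) := fun β hβ => by
  simpa only [energy, primitive_neg_comp_neg, Pi.neg_apply] using h _ hβ.neg_comp_neg

theorem ae_le (h : IsDominatedBy μ b a) (hb : MemLp b 2 μ) {M : ℝ} (hM : 0 ≤ M)
    (ha : ∀ᵐ x ∂μ, a x ≤ M) : ∀ᵐ x ∂μ, b x ≤ M := by
  have hle : ∀ m > M, ∀ᵐ x ∂μ, b x ≤ m := fun m hMm => by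
    have hm : 0 < m := hM.trans_lt hMm
    have hβ := isTruncation_step hm
    obtain ⟨K, hK⟩ := hβ.lipschitz
    have hja : energy μ (step m) a = 0 := integral_eq_zero_of_ae <| by
      filter_upwards [ha] with x hx
      exact primitive_step_eq_zero hm (hx.trans hMm.le)
    have hjb : energy μ (step m) b = 0 := le_antisymm ((h _ hβ).trans_eq hja)
      (integral_nonneg fun x => primitive_step_nonneg hm (b x))
    rw [energy, integral_eq_zero_iff_of_nonneg (fun x => primitive_step_nonneg hm (b x))
      (integrable_primitive_comp hK hβ.map_zero hb)] at hjb
    filter_upwards [hjb] with x hx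
    exact not_lt.1 fun hmx => (primitive_step_pos hm hmx).ne' hx
  obtain ⟨m, -, hMm, hm⟩ := exists_seq_strictAnti_tendsto M
  filter_upwards [ae_all_iff.2 fun n => hle (m n) (hMm n)] with x hx
  exact ge_of_tendsto' hm hx

theorem lintegral_ofReal_le (h : IsDominatedBy μ b a) (hb : MemLp b 2 μ) (ha : MemLp a 2 μ) :
    ∫⁻ x, ENNReal.ofReal (b x) ∂μ ≤ ∫⁻ x, ENNReal.ofReal (a x) ∂μ := by
  obtain ⟨m, -, hm0, hm⟩ := exists_seq_strictAnti_tendsto (0 : ℝ)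
  have hint : ∀ n {v : α → ℝ}, MemLp v 2 μ → Integrable (fun x => primitive (step (m n)) (v x)) μ :=
    fun n v hv =>
      have hβ := isTruncation_step (hm0 n)
      have ⟨_, hK⟩ := hβ.lipschitz
      integrable_primitive_comp hK hβ.map_zero hv
  have hfatou : ∀ x, ENNReal.ofReal (b x) ≤
      liminf (fun n => ENNReal.ofReal (primitive (step (m n)) (b x))) atTop := fun x => by
    have hlim : Tendsto (fun n => ENNReal.ofReal (b x - 2 * m n)) atTop
        (𝓝 (ENNReal.ofReal (b x))) :=
      (ENNReal.continuous_ofReal.tendsto _).comp <| by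
        simpa only [mul_zero, sub_zero] using (hm.const_mul 2).const_sub (b x)
    rw [← hlim.liminf_eq]
    exact liminf_le_liminf (Eventually.of_forall fun n =>
      ENNReal.ofReal_le_ofReal (sub_le_primitive_step (hm0 n) (b x)))
  have hle : ∀ n, ∫⁻ x, ENNReal.ofReal (primitive (step (m n)) (b x)) ∂μ ≤
      ∫⁻ x, ENNReal.ofReal (a x) ∂μ := fun n => by
    have hnonneg : ∀ v : α → ℝ, 0 ≤ᵐ[μ] fun x => primitive (step (m n)) (v x) := fun v =>
      Eventually.of_forall fun x => primitive_step_nonneg (hm0 n) (v x)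
    rw [← ofReal_integral_eq_lintegral_ofReal (hint n hb) (hnonneg b)]
    refine (ENNReal.ofReal_le_ofReal (h _ (isTruncation_step (hm0 n)))).trans ?_
    rw [energy, ofReal_integral_eq_lintegral_ofReal (hint n ha) (hnonneg a)]
    refine lintegral_mono fun x =>
      (ENNReal.ofReal_le_ofReal (primitive_step_le (hm0 n) (a x))).trans_eq ?_
    rw [ENNReal.ofReal_max, ENNReal.ofReal_zero, max_eq_left zero_le]
  calc ∫⁻ x, ENNReal.ofReal (b x) ∂μ
      ≤ ∫⁻ x, liminf (fun n => ENNReal.ofReal (primitive (step (m n)) (b x))) atTop ∂μ :=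
        lintegral_mono hfatou
    _ ≤ liminf (fun n => ∫⁻ x, ENNReal.ofReal (primitive (step (m n)) (b x)) ∂μ) atTop :=
        lintegral_liminf_le' fun n => (hint n hb).aemeasurable.ennreal_ofReal
    _ ≤ liminf (fun _ : ℕ => ∫⁻ x, ENNReal.ofReal (a x) ∂μ) atTop :=
        liminf_le_liminf (Eventually.of_forall hle)
    _ = ∫⁻ x, ENNReal.ofReal (a x) ∂μ := liminf_const _

theorem ae_nonneg (h : IsDominatedBy μ b a) (hb : MemLp b 2 μ) (ha : 0 ≤ᵐ[μ] a) :
    0 ≤ᵐ[μ] b := by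
  filter_upwards [h.neg.ae_le hb.neg le_rfl (ha.mono fun x hx => neg_nonpos.2 hx)] with x hx
  exact neg_nonpos.1 hx

theorem eLpNorm_top_le (h : IsDominatedBy μ b a) (hb : MemLp b 2 μ) :
    eLpNorm b ⊤ μ ≤ eLpNorm a ⊤ μ := by
  rcases eq_or_ne (eLpNorm a ⊤ μ) ⊤ with htop | htop
  · exact le_top.trans_eq htop.symm
  set M := (eLpNorm a ⊤ μ).toReal
  have haM : ∀ᵐ x ∂μ, |a x| ≤ M := by
    filter_upwards [ae_le_eLpNormEssSup (f := a) (μ := μ)] with x hx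
    rw [← eLpNorm_exponent_top, Real.enorm_eq_ofReal_abs] at hx
    exact (ENNReal.ofReal_le_iff_le_toReal htop).1 hx
  have hupper := h.ae_le hb (M := M) ENNReal.toReal_nonneg (haM.mono fun x hx => (abs_le.1 hx).2)
  have hlower := h.neg.ae_le hb.neg (M := M) ENNReal.toReal_nonneg
    (haM.mono fun x hx => neg_le.1 (abs_le.1 hx).1)
  rw [← ENNReal.ofReal_toReal htop, eLpNorm_exponent_top]
  refine eLpNormEssSup_le_of_ae_bound ?_
  filter_upwards [hupper, hlower] with x hx hx'
  exact abs_le.2 ⟨neg_le.1 hx', hx⟩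

end IsDominatedBy

theorem enorm_eq_ofReal_add_ofReal_neg (r : ℝ) :
    ‖r‖ₑ = ENNReal.ofReal r + ENNReal.ofReal (-r) := by
  rw [Real.enorm_eq_ofReal_abs]
  rcases le_total 0 r with h | h
  · rw [abs_of_nonneg h, ENNReal.ofReal_of_nonpos (neg_nonpos.2 h), add_zero]
  · rw [abs_of_nonpos h, ENNReal.ofReal_of_nonpos h, zero_add]

theorem eLpNorm_one_eq_lintegral_ofReal_add (ha : AEStronglyMeasurable a μ) :
    eLpNorm a 1 μ = ∫⁻ x, ENNReal.ofReal (a x) ∂μ + ∫⁻ x, ENNReal.ofReal (-a x) ∂μ := by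
  rw [eLpNorm_one_eq_lintegral_enorm, ← lintegral_add_left' ha.aemeasurable.ennreal_ofReal]
  simp only [enorm_eq_ofReal_add_ofReal_neg]

theorem IsDominatedBy.eLpNorm_one_le (h : IsDominatedBy μ b a) (hb : MemLp b 2 μ)
    (ha : MemLp a 2 μ) : eLpNorm b 1 μ ≤ eLpNorm a 1 μ := by
  rw [eLpNorm_one_eq_lintegral_ofReal_add hb.1, eLpNorm_one_eq_lintegral_ofReal_add ha.1]
  exact add_le_add (h.lintegral_ofReal_le hb ha) (h.neg.lintegral_ofReal_le hb.neg ha.neg)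

end Domination

section WeakSolution

variable {d : ℕ} {p T t : ℝ} {u₀ : L2 d} {u : ℝ → L2 d}

theorem IsWeakSolution.isDominatedBy (hp : 1 < p) (hu : IsWeakSolution p T u₀ u)
    (ht : t ∈ Icc 0 T) : IsDominatedBy volume (u t) u₀ := fun _ hβ =>
  hu.energy_le hp hβ ht

theorem IsWeakSolution.eLpNorm_top_le (hp : 1 < p) (hu : IsWeakSolution p T u₀ u)
    (ht : t ∈ Icc 0 T) : eLpNorm (u t) ⊤ volume ≤ eLpNorm u₀ ⊤ volume :=
  (hu.isDominatedBy hp ht).eLpNorm_top_le (Lp.memLp _)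

theorem IsWeakSolution.ae_nonneg (hp : 1 < p) (hu : IsWeakSolution p T u₀ u)
    (h₀ : 0 ≤ᵐ[volume] u₀) (ht : t ∈ Icc 0 T) : 0 ≤ᵐ[volume] u t :=
  (hu.isDominatedBy hp ht).ae_nonneg (Lp.memLp _) h₀

theorem IsWeakSolution.eLpNorm_one_le (hp : 1 < p) (hu : IsWeakSolution p T u₀ u)
    (ht : t ∈ Icc 0 T) : eLpNorm (u t) 1 volume ≤ eLpNorm u₀ 1 volume :=
  (hu.isDominatedBy hp ht).eLpNorm_one_le (Lp.memLp _) (Lp.memLp _)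

theorem IsWeakSolution.memLp_one (hp : 1 < p) (hu : IsWeakSolution p T u₀ u)
    (h₀ : MemLp u₀ 1 volume) (ht : t ∈ Icc 0 T) : MemLp (u t) 1 volume :=
  ⟨Lp.aestronglyMeasurable _, (hu.eLpNorm_one_le hp ht).trans_lt h₀.2⟩

end WeakSolution

/-! ### Measurability in space and time -/

section SpaceTime

variable {d : ℕ} {T : ℝ}

theorem cylMeasure_eq_prod (d : ℕ) (T : ℝ) :
    cylMeasure d T = (volume.restrict (Ioo 0 T)).prod (volume : Measure (Space d)) := by
  rw [cylMeasure, Measure.volume_eq_prod, ← Measure.prod_restrict, Measure.restrict_univ]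

variable {V : Type*} [NormedAddCommGroup V] [NormedSpace ℝ V] [FiniteDimensional ℝ V]
  [MeasurableSpace V] [BorelSpace V] {μ : Measure V} [μ.IsAddHaarMeasure]

theorem continuous_mollify_apply (n : ℕ) (x : V) :
    Continuous fun v : Lp ℝ 2 μ => mollify μ n v x := by
  set ρ : V → ℝ := fun y => (stdBump V n).normed μ (x - y)
  have hρ : MemLp ρ 2 μ :=
    ((stdBump V n).continuous_normed.comp (by fun_prop)).memLp_of_hasCompactSupport
      ((stdBump V n).hasCompactSupport_normed.comp_homeomorph (Homeomorph.subLeft x))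
  have hinner : ∀ v : Lp ℝ 2 μ, mollify μ n v x = inner ℝ (hρ.toLp ρ) v := fun v => by
    rw [mollify_apply, L2.inner_def]
    refine integral_congr_ae ?_
    filter_upwards [hρ.coeFn_toLp] with y hy
    rw [hy, Real.inner_apply, smul_eq_mul]
  simp only [hinner]
  fun_prop

theorem exists_stronglyMeasurable_ae_eq {X : Type*} [TopologicalSpace X]
    [TopologicalSpace.MetrizableSpace X] [SecondCountableTopology X] [MeasurableSpace X]
    [OpensMeasurableSpace X] {w : X → Lp ℝ 2 μ} (hw : Continuous w) :
    ∃ W : X × V → ℝ, StronglyMeasurable W ∧ ∀ t, (fun x => W (t, x)) =ᵐ[μ] w t := by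
  have hloc : ∀ t, LocallyIntegrable (w t : V → ℝ) μ := fun t =>
    (Lp.memLp (w t)).locallyIntegrable one_le_two
  have hmeas : ∀ n, Measurable (Function.uncurry fun t x => mollify μ n (w t) x) := fun n =>
    (stronglyMeasurable_uncurry_of_continuous_of_stronglyMeasurable
      (fun x => (continuous_mollify_apply n x).comp hw)
      fun t => (contDiff_mollify (hloc t) n).continuous.stronglyMeasurable).measurable
  refine ⟨_, (Measurable.limsup hmeas).stronglyMeasurable, fun t => ?_⟩
  filter_upwards [ae_tendsto_mollify (hloc t)] with x hx
  exact hx.limsup_eq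

theorem exists_isSpaceTimeVersion {u : ℝ → L2 d} (hT : 0 ≤ T) (hu : ContinuousOn u (Icc 0 T)) :
    ∃ U, IsSpaceTimeVersion T u U := by
  obtain ⟨U, hU, hUu⟩ := exists_stronglyMeasurable_ae_eq (w := fun t => u (projIcc 0 T hT t))
    (hu.comp_continuous (by fun_prop) fun t => (projIcc 0 T hT t).2)
  refine ⟨U, hU.aestronglyMeasurable, ?_⟩
  filter_upwards [ae_restrict_mem measurableSet_Ioo] with t ht
  simpa only [projIcc_of_mem hT (Ioo_subset_Icc_self ht)] using hUu t

theorem IsSpaceTimeVersion.ae_mem {u : ℝ → L2 d} {U : ℝ × Space d → ℝ}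
    (hU : IsSpaceTimeVersion T u U) {S : Set ℝ} (hS : MeasurableSet S)
    (hu : ∀ᵐ t ∂(volume.restrict (Ioo 0 T)), ∀ᵐ x, u t x ∈ S) :
    ∀ᵐ z ∂(cylMeasure d T), U z ∈ S := by
  obtain ⟨hmeas, hver⟩ := hU
  rw [cylMeasure_eq_prod] at hmeas ⊢
  have hmk : ∀ᵐ z ∂((volume.restrict (Ioo 0 T)).prod volume), hmeas.mk U z ∈ S := by
    refine (Measure.ae_prod_mem_iff_ae_ae_mem (hmeas.stronglyMeasurable_mk.measurable hS)).2 ?_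
    filter_upwards [hu, hver, Measure.ae_ae_of_ae_prod hmeas.ae_eq_mk] with t hut hUt hmkt
    filter_upwards [hut, hUt, hmkt] with x hx hUx hmkx
    rwa [mem_preimage, ← hmkx, hUx]
  filter_upwards [hmeas.ae_eq_mk, hmk] with z hz hzS
  rwa [hz]

theorem IsSpaceTimeVersion.memLp_top {u : ℝ → L2 d} {U : ℝ × Space d → ℝ}
    (hU : IsSpaceTimeVersion T u U) {B : ℝ≥0∞} (hB : B ≠ ⊤)
    (hu : ∀ᵐ t ∂(volume.restrict (Ioo 0 T)), eLpNorm (u t) ⊤ volume ≤ B) :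
    MemLp U ⊤ (cylMeasure d T) := by
  refine memLp_top_of_bound hU.1 B.toReal ((hU.ae_mem (isClosed_closedBall (x := 0)
    (ε := B.toReal)).measurableSet ?_).mono fun z => mem_closedBall_zero_iff.1)
  filter_upwards [hu] with t ht
  filter_upwards [ae_le_eLpNormEssSup (f := u t) (μ := volume)] with x hx
  rw [mem_closedBall_zero_iff, ← toReal_enorm]
  exact ENNReal.toReal_mono hB (hx.trans ht)

end SpaceTime

section BochnerL1

variable {V : Type*} [NormedAddCommGroup V] [NormedSpace ℝ V] [FiniteDimensional ℝ V]
  [MeasurableSpace V] [BorelSpace V] {μ : Measure V}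

theorem tendsto_eLpNorm_cutoff_mul_sub {f : V → ℝ} (hf : Integrable f μ) :
    Tendsto (fun n => eLpNorm (fun x => cutoff n x * f x - f x) 1 μ) atTop (𝓝 0) := by
  simp only [eLpNorm_one_eq_lintegral_enorm, ← ofReal_norm]
  refine tendsto_lintegral_norm_of_dominated_convergence (bound := fun x => ‖f x‖)
    (fun n => (isTestFunction_cutoff n).1.continuous.aestronglyMeasurable.mul hf.1)
    hf.norm.hasFiniteIntegral (fun n => Eventually.of_forall fun x => ?_)
    (Eventually.of_forall fun x => ?_)
  · rw [norm_mul]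
    exact mul_le_of_le_one_left (norm_nonneg _) (abs_cutoff_le_one n x)
  · simpa only [one_mul] using (tendsto_cutoff x).mul_const (f x)

variable [IsFiniteMeasureOnCompacts μ]

theorem memLp_cutoff (n : ℕ) (q : ℝ≥0∞) : MemLp (cutoff n : V → ℝ) q μ :=
  (isTestFunction_cutoff n).1.continuous.memLp_of_hasCompactSupport (isTestFunction_cutoff n).2

/-- The cutoff `χ_n` as an element of `L²`. -/
noncomputable def cutoffL2 (μ : Measure V) [IsFiniteMeasureOnCompacts μ] (n : ℕ) : Lp ℝ 2 μ :=
  (memLp_cutoff n 2).toLp (cutoff n)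

theorem coeFn_cutoffL2 (n : ℕ) : cutoffL2 μ n =ᵐ[μ] cutoff n :=
  (memLp_cutoff n 2).coeFn_toLp

theorem aestronglyMeasurable_L1_of_L2 {X : Type*} [MeasurableSpace X] {ν : Measure X}
    {u : X → Lp ℝ 2 μ} {v : X → Lp ℝ 1 μ} (hu : AEStronglyMeasurable u ν)
    (hvu : ∀ᵐ t ∂ν, v t =ᵐ[μ] u t) : AEStronglyMeasurable v ν := by
  set L := fun n => (mul ℝ ℝ).holderL μ 2 2 1 (cutoffL2 μ n)
  refine aestronglyMeasurable_of_tendsto_ae atTop (f := fun n t => L n (u t))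
    (fun n => (L n).continuous.comp_aestronglyMeasurable hu) ?_
  filter_upwards [hvu] with t ht
  rw [Lp.tendsto_Lp_iff_tendsto_eLpNorm']
  refine (tendsto_eLpNorm_cutoff_mul_sub (L1.integrable_coeFn (v t))).congr fun n =>
    eLpNorm_congr_ae ?_
  filter_upwards [ht, coeFn_cutoffL2 (μ := μ) n,
    (mul ℝ ℝ).coeFn_holder (r := 1) (cutoffL2 μ n) (u t)] with x hx hcx hLx
  change _ = L n (u t) x - v t x
  rw [show L n (u t) x = _ from hLx, mul_apply', hcx, hx]

theorem memLinftyL1_of_continuousOn {d : ℕ} {T : ℝ} {u : ℝ → L2 d}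
    (hc : ContinuousOn u (Icc 0 T)) {B : ℝ≥0∞} (hB : B ≠ ⊤)
    (h : ∀ t ∈ Icc 0 T, eLpNorm (u t) 1 volume ≤ B) : MemLinftyL1 T u := by
  have hL1 : ∀ t ∈ Icc 0 T, ∃ v : Lp ℝ 1 (volume : Measure (Space d)),
      v =ᵐ[volume] u t ∧ ‖v‖ ≤ B.toReal := fun t ht => by
    have hut : MemLp (u t) 1 volume :=
      ⟨Lp.aestronglyMeasurable _, (h t ht).trans_lt hB.lt_top⟩
    refine ⟨hut.toLp (u t), hut.coeFn_toLp, ?_⟩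
    rw [Lp.norm_toLp]
    exact ENNReal.toReal_mono hB (h t ht)
  choose! v hvu hvB using hL1
  have hae : ∀ᵐ t ∂(volume.restrict (Ioo 0 T)), t ∈ Icc 0 T :=
    (ae_restrict_mem measurableSet_Ioo).mono fun t ht => Ioo_subset_Icc_self ht
  have hu : AEStronglyMeasurable u (volume.restrict (Ioo 0 T)) :=
    (hc.mono Ioo_subset_Icc_self).aestronglyMeasurable measurableSet_Ioo
  exact ⟨v, memLp_top_of_bound (aestronglyMeasurable_L1_of_L2 hu (hae.mono hvu)) B.toReal
    (hae.mono hvB), hae.mono hvu⟩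

end BochnerL1

/-! ### Conservation of mass -/

section CutoffFlux

variable {V : Type*} [NormedAddCommGroup V] [NormedSpace ℝ V] [FiniteDimensional ℝ V]
  [MeasurableSpace V] [BorelSpace V] {μ : Measure V} [μ.IsAddHaarMeasure] {p q : ℝ}

theorem integral_norm_fderiv_cutoff_rpow (n : ℕ) (p : ℝ) :
    ∫ x, ‖fderiv ℝ (cutoff n) x‖ ^ p ∂μ =
      ((n : ℝ) + 1) ^ (Module.finrank ℝ V - p) *
        ∫ x, ‖fderiv ℝ (unitBump V : V → ℝ) x‖ ^ p ∂μ := by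
  have hn : (0 : ℝ) < n + 1 := by positivity
  simp only [fderiv_cutoff, norm_smul, norm_inv, Real.norm_of_nonneg hn.le,
    Real.mul_rpow (inv_nonneg.2 hn.le) (norm_nonneg _)]
  rw [integral_const_mul, Measure.integral_comp_inv_smul_of_nonneg μ
    (fun x => ‖fderiv ℝ (unitBump V : V → ℝ) x‖ ^ p) hn.le, Real.rpow_sub hn,
    Real.rpow_natCast, Real.inv_rpow hn.le, smul_eq_mul]
  ring

theorem integral_norm_fderiv_cutoff_rpow_le (hp : Module.finrank ℝ V ≤ p) (n : ℕ) :
    ∫ x, ‖fderiv ℝ (cutoff n) x‖ ^ p ∂μ ≤ ∫ x, ‖fderiv ℝ (unitBump V : V → ℝ) x‖ ^ p ∂μ := by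
  rw [integral_norm_fderiv_cutoff_rpow]
  exact mul_le_of_le_one_left (integral_nonneg fun x => by positivity)
    (Real.rpow_le_one_of_one_le_of_nonpos (by simp) (sub_nonpos.2 hp))

variable {X E : Type*} [MeasurableSpace X] {ν : Measure X} [IsFiniteMeasure ν]
  [NormedAddCommGroup E] {F : X × V → E}

theorem memLp_fderiv_cutoff_snd (n : ℕ) (r : ℝ≥0∞) :
    MemLp (fun z : X × V => fderiv ℝ (cutoff n) z.2) r (ν.prod μ) :=
  (memLp_fderiv_of_isTestFunction (isTestFunction_cutoff n) r).comp_snd ν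

theorem integrable_norm_fderiv_cutoff_mul_norm (hpq : p.HolderConjugate q)
    (hF : MemLp F (ENNReal.ofReal q) (ν.prod μ)) (n : ℕ) :
    Integrable (fun z => ‖fderiv ℝ (cutoff n) z.2‖ * ‖F z‖) (ν.prod μ) :=
  have := hpq.ennrealOfReal
  (memLp_fderiv_cutoff_snd n (ENNReal.ofReal p)).norm.integrable_mul hF.norm

theorem integral_norm_fderiv_cutoff_mul_norm_le (hpq : p.HolderConjugate q)
    (hp : Module.finrank ℝ V ≤ p) (hF : MemLp F (ENNReal.ofReal q) (ν.prod μ)) (n : ℕ) :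
    ∫ z, ‖fderiv ℝ (cutoff n) z.2‖ * ‖F z‖ ∂(ν.prod μ) ≤
      (ν.real univ * ∫ x, ‖fderiv ℝ (unitBump V : V → ℝ) x‖ ^ p ∂μ) ^ (1 / p) *
        (∫ z in {z : X × V | (n : ℝ) + 1 ≤ ‖z.2‖}, ‖F z‖ ^ q ∂(ν.prod μ)) ^ (1 / q) := by
  set S := {z : X × V | (n : ℝ) + 1 ≤ ‖z.2‖}
  have hχ := memLp_fderiv_cutoff_snd (ν := ν) (μ := μ) n (ENNReal.ofReal p)
  have hsupp : ∀ z ∉ S, ‖fderiv ℝ (cutoff n) z.2‖ * ‖F z‖ = 0 := fun z hz => by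
    rw [fderiv_cutoff_eq_zero (not_le.1 hz), norm_zero, zero_mul]
  have hsupp' : ∀ z ∉ S, ‖fderiv ℝ (cutoff n) z.2‖ ^ p = 0 := fun z hz => by
    rw [fderiv_cutoff_eq_zero (not_le.1 hz), norm_zero, Real.zero_rpow hpq.ne_zero]
  have hgrad : ∫ z in S, ‖fderiv ℝ (cutoff n) z.2‖ ^ p ∂(ν.prod μ) ≤
      ν.real univ * ∫ x, ‖fderiv ℝ (unitBump V : V → ℝ) x‖ ^ p ∂μ := by
    rw [setIntegral_eq_integral_of_forall_compl_eq_zero hsupp',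
      integral_fun_snd fun x => ‖fderiv ℝ (cutoff n) x‖ ^ p, smul_eq_mul]
    exact mul_le_mul_of_nonneg_left (integral_norm_fderiv_cutoff_rpow_le hp n) measureReal_nonneg
  have hHolder := integral_mul_norm_le_Lp_mul_Lq hpq (hχ.restrict S).norm (hF.restrict S).norm
  simp only [norm_norm] at hHolder
  rw [setIntegral_eq_integral_of_forall_compl_eq_zero hsupp] at hHolder
  have hp' : 0 ≤ 1 / p := one_div_nonneg.2 hpq.nonneg
  refine hHolder.trans ?_
  gcongr

theorem tendsto_integral_norm_fderiv_cutoff_mul_norm (hpq : p.HolderConjugate q)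
    (hp : Module.finrank ℝ V ≤ p) (hF : MemLp F (ENNReal.ofReal q) (ν.prod μ)) :
    Tendsto (fun n => ∫ z, ‖fderiv ℝ (cutoff n) z.2‖ * ‖F z‖ ∂(ν.prod μ)) atTop (𝓝 0) := by
  set S := fun n : ℕ => {z : X × V | (n : ℝ) + 1 ≤ ‖z.2‖}
  have hSm : ∀ n, MeasurableSet (S n) := fun n =>
    measurableSet_le measurable_const measurable_snd.norm
  have hSanti : Antitone S := fun m n hmn z (hz : (n : ℝ) + 1 ≤ ‖z.2‖) =>
    (add_le_add_left (Nat.cast_le.2 hmn) 1).trans hz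
  have hSempty : ⋂ n, S n = ∅ := eq_empty_of_forall_notMem fun z hz => by
    obtain ⟨n, hn⟩ := exists_nat_ge ‖z.2‖
    exact absurd ((mem_iInter.1 hz n).trans hn) (by simp)
  have hFq : Integrable (fun z => ‖F z‖ ^ q) (ν.prod μ) := by
    simpa only [ENNReal.toReal_ofReal hpq.symm.nonneg] using
      hF.integrable_norm_rpow (ENNReal.ofReal_pos.2 hpq.symm.pos).ne' ENNReal.ofReal_ne_top
  have htail := tendsto_setIntegral_of_antitone hSm hSanti ⟨0, hFq.integrableOn⟩
  rw [hSempty, setIntegral_empty] at htail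
  have hq : 0 < 1 / q := one_div_pos.2 hpq.symm.pos
  have hbound := (htail.rpow_const (Or.inr hq.le)).const_mul
    ((ν.real univ * ∫ x, ‖fderiv ℝ (unitBump V : V → ℝ) x‖ ^ p ∂μ) ^ (1 / p))
  rw [Real.zero_rpow hq.ne', mul_zero] at hbound
  exact squeeze_zero (fun n => integral_nonneg fun z => by positivity)
    (integral_norm_fderiv_cutoff_mul_norm_le hpq hp hF) hbound

end CutoffFlux

section Conservation

variable {d : ℕ} {p T : ℝ}

theorem HasWeakGradient.ae_eq {v : Space d → ℝ} {G₁ G₂ : Space d → Space d}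
    (h₁ : HasWeakGradient v G₁) (h₂ : HasWeakGradient v G₂) : G₁ =ᵐ[volume] G₂ := by
  refine ae_eq_of_integral_contDiff_smul_eq h₁.2.1 h₂.2.1 fun φ hφ hφs => ?_
  have hint : ∀ {G : Space d → Space d}, LocallyIntegrable G → Integrable fun x => φ x • G x :=
    fun hG => hG.integrable_smul_left_of_hasCompactSupport hφ.continuous hφs
  refine ext_inner_left ℝ fun y => ?_
  rw [← integral_inner (hint h₁.2.1), ← integral_inner (hint h₂.2.1)]
  simpa only [inner_smul_right, real_inner_comm y] using
    neg_injective ((h₁.2.2 φ ⟨hφ, hφs⟩ y).symm.trans (h₂.2.2 φ ⟨hφ, hφs⟩ y))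

theorem inner_cutoffL2 {V : Type*} [NormedAddCommGroup V] [NormedSpace ℝ V]
    [FiniteDimensional ℝ V] [MeasurableSpace V] [BorelSpace V] {μ : Measure V}
    [IsFiniteMeasureOnCompacts μ] (n : ℕ) (v : Lp ℝ 2 μ) :
    inner ℝ (cutoffL2 μ n) v = ∫ x, cutoff n x * v x ∂μ := by
  rw [L2.inner_def]
  refine integral_congr_ae ?_
  filter_upwards [coeFn_cutoffL2 (μ := μ) n] with x hx
  rw [hx, Real.inner_apply]

theorem IsNegPLaplacian.abs_inner_cutoffL2_le (hp : 1 < p) {v f : L2 d}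
    (h : IsNegPLaplacian p v f) {G : Space d → Space d} (hG : HasWeakGradient v G) (n : ℕ) :
    |inner ℝ (cutoffL2 volume n) f| ≤
      ∫ x, ‖fderiv ℝ (cutoff n) x‖ * ‖‖G x‖ ^ (p - 2) • G x‖ := by
  obtain ⟨G', hG'p, hG', hdiv⟩ := h
  have hGG' := hG.ae_eq hG'
  have := ofReal_holderConjugate_conjExponent hp
  have hχ := isTestFunction_cutoff (V := Space d) n
  have hweak : ∫ x, fderiv ℝ (cutoff n) x (‖G' x‖ ^ (p - 2) • G' x) = ∫ x, cutoff n x * f x := by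
    simpa only [mul_neg, integral_neg, neg_neg] using hdiv.2.2 _ hχ
  rw [inner_cutoffL2, ← hweak, ← Real.norm_eq_abs]
  refine norm_integral_le_of_norm_le ?_ ?_
  · exact (memLp_fderiv_of_isTestFunction hχ (ENNReal.ofReal p)).norm.integrable_mul
      (memLp_norm_rpow_sub_two_smul hp (hG'p.ae_eq hGG'.symm)).norm
  · filter_upwards [hGG'] with x hx
    rw [hx]
    exact le_opNorm _ _

variable {u₀ : L2 d} {u : ℝ → L2 d} {G : ℝ × Space d → Space d}

theorem IsWeakSolution.abs_inner_cutoffL2_sub_le (hp : 1 < p) (hu : IsWeakSolution p T u₀ u)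
    (hG : MemLp G (ENNReal.ofReal p) (cylMeasure d T))
    (hGu : ∀ᵐ t ∂(volume.restrict (Ioo 0 T)), HasWeakGradient (u t) fun x => G (t, x))
    (n : ℕ) {t : ℝ} (ht : t ∈ Icc 0 T) :
    |inner ℝ (cutoffL2 volume n) (u t) - inner ℝ (cutoffL2 volume n) u₀| ≤
      ∫ z, ‖fderiv ℝ (cutoff n) z.2‖ * ‖‖G z‖ ^ (p - 2) • G z‖ ∂(cylMeasure d T) := by
  obtain ⟨a, -, ha⟩ := hu.equation
  set flux : ℝ → ℝ := fun s =>
    ∫ x, ‖fderiv ℝ (cutoff n) x‖ * ‖‖G (s, x)‖ ^ (p - 2) • G (s, x)‖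
  rw [cylMeasure_eq_prod] at hG ⊢
  have hint := integrable_norm_fderiv_cutoff_mul_norm (Real.HolderConjugate.conjExponent hp)
    (memLp_norm_rpow_sub_two_smul hp hG) n
  have hflux : IntegrableOn flux (Ioo 0 T) := hint.integral_prod_left
  have hsub : Ioo 0 t ⊆ Ioo 0 T := Ioo_subset_Ioo_right ht.2
  have hbound : |inner ℝ (cutoffL2 volume n) (u t) - inner ℝ (cutoffL2 volume n) (u 0)| ≤
      ∫ s in (0 : ℝ)..t, flux s := by
    refine abs_sub_le_integral_of_locally_absolutelyContinuous
      (f := fun s => inner ℝ (cutoffL2 volume n) (u s)) ht.1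
      ((innerSL ℝ _).continuous.comp_continuousOn
        (hu.continuousOn.mono (Icc_subset_Icc_right ht.2)))
      (fun r hr s hs => absolutelyContinuousOnInterval_of_dist_le_mul
        (hu.absolutelyContinuousOnInterval (hsub hr) (hsub hs)) fun x _ y _ =>
          (innerSL ℝ (cutoffL2 volume n)).dist_le_opNorm (u x) (u y))
      ((intervalIntegrable_iff_integrableOn_Ioo_of_le ht.1).2 (hflux.mono_set hsub)) ?_
    filter_upwards [ae_restrict_of_ae_restrict_of_subset hsub ha,
      ae_restrict_of_ae_restrict_of_subset hsub hGu] with s ⟨hAs, hus⟩ hGs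
    refine ⟨_, ?_, (innerSL ℝ (cutoffL2 volume n)).hasFDerivAt.comp_hasDerivAt s hus⟩
    rw [map_neg, abs_neg]
    exact hAs.abs_inner_cutoffL2_le hp hGs n
  rw [hu.initial] at hbound
  refine hbound.trans ?_
  rw [intervalIntegral.integral_of_le ht.1, integral_Ioc_eq_integral_Ioo, integral_prod _ hint]
  exact setIntegral_mono_set hflux
    (Eventually.of_forall fun s => integral_nonneg fun x => by positivity) hsub.eventuallyLE

theorem IsWeakSolution.integral_eq (hp : 1 < p) (hu : IsWeakSolution p T u₀ u)
    (hdp : (d : ℝ) ≤ p) (h₀ : MemLp u₀ 1 volume) {t : ℝ} (ht : t ∈ Icc 0 T) :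
    ∫ x, u t x = ∫ x, u₀ x := by
  obtain ⟨G, hG, hGu⟩ := hu.gradient
  have hdim : (Module.finrank ℝ (Space d) : ℝ) ≤ p := by rwa [finrank_euclideanSpace_fin]
  have hF := memLp_norm_rpow_sub_two_smul hp hG
  rw [cylMeasure_eq_prod] at hF
  have hvanish : Tendsto (fun n => |inner ℝ (cutoffL2 volume n) (u t) -
      inner ℝ (cutoffL2 volume n) u₀|) atTop (𝓝 0) :=
    squeeze_zero (fun _ => abs_nonneg _)
      (fun n => hu.abs_inner_cutoffL2_sub_le hp hG hGu n ht) (by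
        rw [cylMeasure_eq_prod]
        exact tendsto_integral_norm_fderiv_cutoff_mul_norm
          (Real.HolderConjugate.conjExponent hp) hdim hF)
  have hmass : Tendsto (fun n => |inner ℝ (cutoffL2 volume n) (u t) -
      inner ℝ (cutoffL2 volume n) u₀|) atTop (𝓝 |(∫ x, u t x) - ∫ x, u₀ x|) := by
    simp only [inner_cutoffL2]
    exact ((tendsto_integral_cutoff_mul (memLp_one_iff_integrable.1 (hu.memLp_one hp h₀ ht))).sub
      (tendsto_integral_cutoff_mul (memLp_one_iff_integrable.1 h₀))).abs
  exact sub_eq_zero.1 (abs_eq_zero.1 (tendsto_nhds_unique hmass hvanish))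

end Conservation

end PLaplace

theorem theorem2p4 (d : ℕ) (hd : 1 ≤ d) (p : ℝ) (hp : 1 < p) (T : ℝ) (hT : 0 < T)
    (u₀ : PLaplace.L2 d) (u : ℝ → PLaplace.L2 d)
    (hu : PLaplace.IsWeakSolution p T u₀ u) :
    ∃ U : ℝ × PLaplace.Space d → ℝ, PLaplace.IsSpaceTimeVersion T u U ∧
      (MemLp u₀ ⊤ volume →
        MemLp U ⊤ (PLaplace.cylMeasure d T) ∧
          ∀ᵐ t ∂(volume.restrict (Ioo 0 T)), eLpNorm (u t) ⊤ volume ≤ eLpNorm u₀ ⊤ volume) ∧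
      (MemLp u₀ 1 volume →
        PLaplace.MemLinftyL1 T u ∧
          ((∀ᵐ x ∂volume, 0 ≤ u₀ x) → ∀ᵐ z ∂(PLaplace.cylMeasure d T), 0 ≤ U z) ∧
          ((d : ℝ) ≤ p → ∀ t ∈ Icc 0 T,
            Integrable (u t) volume ∧ ∫ x, u t x = ∫ x, u₀ x)) := by
  obtain ⟨U, hU⟩ := PLaplace.exists_isSpaceTimeVersion hT.le hu.continuousOn
  have hIcc : ∀ᵐ t ∂(volume.restrict (Ioo 0 T)), t ∈ Icc 0 T :=
    (ae_restrict_mem measurableSet_Ioo).mono fun t ht => Ioo_subset_Icc_self ht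
  have htop : ∀ᵐ t ∂(volume.restrict (Ioo 0 T)), eLpNorm (u t) ⊤ volume ≤ eLpNorm u₀ ⊤ volume :=
    hIcc.mono fun t ht => hu.eLpNorm_top_le hp ht
  refine ⟨U, hU, fun h₀ => ⟨hU.memLp_top h₀.2.ne htop, htop⟩, fun h₀ => ⟨?_, fun hpos => ?_,
    fun hdp t ht => ⟨memLp_one_iff_integrable.1 (hu.memLp_one hp h₀ ht),
      hu.integral_eq hp hdp h₀ ht⟩⟩⟩
  · exact PLaplace.memLinftyL1_of_continuousOn hu.continuousOn h₀.2.ne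
      fun t ht => hu.eLpNorm_one_le hp ht
  · exact hU.ae_mem measurableSet_Ici (hIcc.mono fun t ht => hu.ae_nonneg hp hpos ht)
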